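/- Let $\mathcal{G}\rightrightarrows M$ be a Lie groupoid (all manifolds finite-dimensional, Hausdorff and second countable) with source $s$ and target $t$, where $(g,h)$ is composable if $s(g)=t(h)$. Let $\mathcal{V}\rightrightarrows E$ be a VB-groupoid over $\mathcal{G}$: a Lie groupoid whose arrows and objects form smooth vector bundles $\pi:\mathcal{V}\to\mathcal{G}$ and $E\to M$ such that the bundle projections form a groupoid morphism and, for every $\lambda\ge 0$, the fiberwise multiplications by $\lambda$ on $\mathcal{V}$ and $E$ form a Lie groupoid morphism. Let $B_p\mathcal{V}$ be the manifold of composable $p$-tuples of $\mathcal{V}$ ($B_0\mathcal{V}=E$), and let $C^p_{VB}(\mathcal{V})$ be the space of smooth functions $\phi:B_p\mathcal{V}\to\mathbb{R}$ that are normalized (they vanish on every tuple containing a unit), fiberwise $1$-homogeneous ($\phi(\lambda\xi_1,\dots,\lambda\xi_p)=\lambda\,\phi(\xi_1,\dots,\xi_p)$ for $\lambda\ge 0$) and, for $p\geq 1$, satisfy 1. $\phi(0_g,\xi_2,\dots,\xi_p)=0$ whenever $(0_g,\xi_2,\dots,\xi_p)\in B_p\mathcal{V}$, 2. $\phi(0_g\cdot\xi_1,\xi_2,\dots,\xi_p)=\phi(\xi_1,\xi_2,\dots,\xi_p)$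 whenever $(\xi_1,\dots,\xi_p)\in B_p\mathcal{V}$ and $0_g$, $\xi_1$ are composable, where $0_g\in\mathcal{V}_g$ is the zero vector. With the differential $\delta:C^{p}_{VB}(\mathcal{V})\to C^{p+1}_{VB}(\mathcal{V})$ given for $p\ge 1$ by $$(\delta\phi)(\xi_1,\dots,\xi_{p+1})=\phi(\xi_2,\dots,\xi_{p+1})+\sum_{i=1}^{p}(-1)^i\phi(\xi_1,\dots,\xi_i\xi_{i+1},\dots,\xi_{p+1})+(-1)^{p+1}\phi(\xi_1,\dots,\xi_p)$$ and for $p=0$ by $(\delta\phi)(\xi)=\phi(s_{\mathcal V}(\xi))-\phi(t_{\mathcal V}(\xi))$, this is a cochain complex $C^\bullet_{VB}(\mathcal{V})$. A Haar system on $\mathcal{G}$ is a family $(\mu^x)_{x\in M}$ of Borel measures on $\mathcal{G}$, finite on compact sets, where $\mu^x$ has support $t^{-1}(x)$, such that $x\mapsto\int f\,d\mu^x$ is smooth for all $f\in C_c^\infty(\mathcal{G})$ and $\int f(gh)\,d\mu^{s(g)}(h)=\int f(k)\,d\mu^{t(g)}(k)$ for all $g\in\mathcal{G}$. A cut-off function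 for it is a function $c\in C^\infty(M)$ such that $t:\operatorname{supp}(c\circ s)\to M$ is proper and $\int c(s(h))\,d\mu^x(h)=1$ for all $x\in M$. Suppose that $\mathcal{G}$ is proper, i.e. $(s,t):\mathcal{G}\to M\times M$ is a proper map, or, more generally, that $\mathcal{G}$ admits a Haar system together with a cut-off function. Then $$H^p\big(C^\bullet_{VB}(\mathcal{V})\big)=0\qquad\text{for all } p\ge 2.$$ -/

import Mathlib

open scoped Manifold ContDiff Topology
open MeasureTheory Bundle

universe u

noncomputable section

/-- A Lie groupoid `G ⇉ M`. Two arrows `g, h` are composable when `src g = tgt h`. The product is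
recorded by a function `mul : G → G → G` of which only the values on composable pairs matter.
Since `src` and `tgt` are submersions, the composable pairs form an embedded submanifold of `G × G`,
and `ContMDiffOn` along it says that the multiplication is smooth on that submanifold. -/
structure LieGroupoid
    {EM HM EG HG : Type*}
    [NormedAddCommGroup EM] [NormedSpace ℝ EM] [TopologicalSpace HM]
    [NormedAddCommGroup EG] [NormedSpace ℝ EG] [TopologicalSpace HG]
    (J : ModelWithCorners ℝ EM HM) (M : Type*) [TopologicalSpace M] [ChartedSpace HM M]
    (I : ModelWithCorners ℝ EG HG) (G : Type*) [TopologicalSpace G] [ChartedSpace HG G] where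
  src : G → M
  tgt : G → M
  one : M → G
  inv : G → G
  mul : G → G → G
  src_one : ∀ x, src (one x) = x
  tgt_one : ∀ x, tgt (one x) = x
  src_mul : ∀ g h, src g = tgt h → src (mul g h) = src h
  tgt_mul : ∀ g h, src g = tgt h → tgt (mul g h) = tgt g
  mul_assoc : ∀ g h k, src g = tgt h → src h = tgt k → mul (mul g h) k = mul g (mul h k)
  one_mul : ∀ g, mul (one (tgt g)) g = g
  mul_one : ∀ g, mul g (one (src g)) = g
  src_inv : ∀ g, src (inv g) = tgt g
  tgt_inv : ∀ g, tgt (inv g) = src g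
  inv_mul : ∀ g, mul (inv g) g = one (src g)
  mul_inv : ∀ g, mul g (inv g) = one (tgt g)
  isSubmersion_src : Manifold.IsSubmersion I J ∞ src
  isSubmersion_tgt : Manifold.IsSubmersion I J ∞ tgt
  contMDiff_one : ContMDiff J I ∞ one
  contMDiff_inv : ContMDiff I I ∞ inv
  contMDiffOn_mul : ContMDiffOn (I.prod I) I ∞ (fun q : G × G => mul q.1 q.2)
    {q | src q.1 = tgt q.2}

namespace LieGroupoid

variable {EM HM EG HG : Type*}
  [NormedAddCommGroup EM] [NormedSpace ℝ EM] [TopologicalSpace HM]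
  [NormedAddCommGroup EG] [NormedSpace ℝ EG] [TopologicalSpace HG]
  {J : ModelWithCorners ℝ EM HM} {M : Type u} [TopologicalSpace M] [ChartedSpace HM M]
  {I : ModelWithCorners ℝ EG HG} {G : Type u} [TopologicalSpace G] [ChartedSpace HG G]

/-- `(g 0, …, g n)` is a string of composable arrows. -/
def Composable (𝒢 : LieGroupoid J M I G) {n : ℕ} (g : Fin (n + 1) → G) : Prop :=
  ∀ i : Fin n, 𝒢.src (g i.castSucc) = 𝒢.tgt (g i.succ)

/-- The set `B_p 𝒢` of composable `p`-tuples, with `B_0 𝒢 = M`. -/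
def Nerve (𝒢 : LieGroupoid J M I G) : ℕ → Type u
  | 0 => M
  | n + 1 => {g : Fin (n + 1) → G // 𝒢.Composable g}

theorem Composable.tail {𝒢 : LieGroupoid J M I G} {n : ℕ} {g : Fin (n + 2) → G}
    (hg : 𝒢.Composable g) : 𝒢.Composable (fun k : Fin (n + 1) => g k.succ) :=
  fun i => hg i.succ

theorem Composable.contractNth {𝒢 : LieGroupoid J M I G} {n : ℕ} {g : Fin (n + 2) → G}
    (hg : 𝒢.Composable g) (j : Fin (n + 2)) :
    𝒢.Composable (Fin.contractNth j 𝒢.mul g) := by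
  intro i
  have h1 := hg i.castSucc
  have h2 := hg i.succ
  have e1 : (i.castSucc.succ : Fin (n + 2)) = i.succ.castSucc := rfl
  have m1 := 𝒢.src_mul _ _ h1
  have m2 := 𝒢.tgt_mul _ _ h2
  rw [e1] at h1 m1
  unfold Fin.contractNth
  simp only [Fin.val_castSucc, Fin.val_succ]
  split_ifs <;> first | omega | (simp only [m1, m2, h1, h2, e1])

/-- The face maps: `face 0` drops the first arrow, `face i` multiplies the `i`-th and the
`(i+1)`-st arrows, and the last face drops the last arrow (`Fin.contractNth (Fin.last _)` forgets
the last entry). On a single arrow the two faces are the source and the target. -/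
def face (𝒢 : LieGroupoid J M I G) : (n : ℕ) → Fin (n + 2) → 𝒢.Nerve (n + 1) → 𝒢.Nerve n
  | 0, i, g => if i = 0 then 𝒢.src (g.1 0) else 𝒢.tgt (g.1 0)
  | _ + 1, i, g =>
      Fin.cases ⟨fun k => g.1 k.succ, g.2.tail⟩
        (fun j => ⟨Fin.contractNth j 𝒢.mul g.1, g.2.contractNth j⟩) i

/-- The differential `δ = ∑ i, (-1)^i ∂_i^*`. -/
def delta (𝒢 : LieGroupoid J M I G) (n : ℕ) : (𝒢.Nerve n → ℝ) →ₗ[ℝ] (𝒢.Nerve (n + 1) → ℝ) :=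
  ∑ i : Fin (n + 2), (-1 : ℝ) ^ (i : ℕ) • LinearMap.funLeft ℝ ℝ (𝒢.face n i)

/-- Smooth functions on `B_p 𝒢`. For `p ≥ 1` this is an embedded submanifold of `G^p`, and
smoothness of a function on it is smoothness, along that subset of the manifold `G^p`, of a function
representing it. -/
def IsSmooth (𝒢 : LieGroupoid J M I G) : (n : ℕ) → (𝒢.Nerve n → ℝ) → Prop
  | 0, φ => ContMDiff J 𝓘(ℝ, ℝ) ∞ (M := M) φ
  | n + 1, φ => ∃ F : (Fin (n + 1) → G) → ℝ,
      ContMDiffOn (ModelWithCorners.pi fun _ : Fin (n + 1) => I) 𝓘(ℝ, ℝ) ∞ F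
        {g | 𝒢.Composable g} ∧
      ∀ g : 𝒢.Nerve (n + 1), φ g = F g.1

/-- The normalization `s_i^* φ = 0` for all degeneracies `s_i`: the strings of composable arrows in
the image of some degeneracy are exactly those that contain a unit. -/
def IsNormalized (𝒢 : LieGroupoid J M I G) : (n : ℕ) → (𝒢.Nerve n → ℝ) → Prop
  | 0, _ => True
  | n + 1, φ => ∀ g : 𝒢.Nerve (n + 1), (∃ (i : Fin (n + 1)) (x : M), g.1 i = 𝒢.one x) → φ g = 0

/-- The groupoid is proper: `(src, tgt) : G → M × M` is a proper map. -/
def IsProper (𝒢 : LieGroupoid J M I G) : Prop :=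
  IsProperMap (fun g : G => (𝒢.src g, 𝒢.tgt g))

/-- A (smooth, left) Haar system: a family of measures `μ x`, finite on compact sets, with support
the target fibre over `x`, which depends smoothly on `x` and is left invariant,
`∫ f (g h) dμ_{src g}(h) = ∫ f dμ_{tgt g}`. -/
structure HaarSystem (𝒢 : LieGroupoid J M I G) [MeasurableSpace G] [BorelSpace G] where
  measure : M → Measure G
  finite_of_isCompact : ∀ (x : M) (K : Set G), IsCompact K → measure x K < ⊤
  measure_compl_fibre : ∀ x, measure x {h | 𝒢.tgt h ≠ x} = 0
  measure_pos : ∀ (x : M) (U : Set G), IsOpen U → (∃ h ∈ U, 𝒢.tgt h = x) → 0 < measure x U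
  smooth : ∀ f : G → ℝ, ContMDiff I 𝓘(ℝ, ℝ) ∞ f → HasCompactSupport f →
    ContMDiff J 𝓘(ℝ, ℝ) ∞ (fun x => ∫ h, f h ∂(measure x))
  left_invariant : ∀ g, (measure (𝒢.src g)).map (𝒢.mul g) = measure (𝒢.tgt g)

/-- `c` is a cut-off function for the Haar system `μ`: it is smooth, the target map is proper on
the support of `c ∘ src`, and `c ∘ src` has integral one over every target fibre. -/
structure HaarSystem.IsCutoff {𝒢 : LieGroupoid J M I G} [MeasurableSpace G] [BorelSpace G]
    (μ : 𝒢.HaarSystem) (c : M → ℝ) : Prop where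
  contMDiff : ContMDiff J 𝓘(ℝ, ℝ) ∞ c
  isProperMap : IsProperMap (fun h : tsupport (fun g : G => c (𝒢.src g)) => 𝒢.tgt h.1)
  integral_eq_one : ∀ x, ∫ h, c (𝒢.src h) ∂(μ.measure x) = 1

end LieGroupoid

/-- Fibrewise multiplication by a scalar on the total space of a vector bundle. -/
def fibreScale {B : Type*} (F : Type*) {W : B → Type*} [∀ b, AddCommGroup (W b)]
    [∀ b, Module ℝ (W b)] (r : ℝ) (v : TotalSpace F W) : TotalSpace F W :=
  ⟨v.proj, r • v.2⟩

/-- A VB-groupoid `𝒱 ⇉ E` over the Lie groupoid `𝒢 = (G ⇉ M)`, where `E → M` and `𝒱 → G` are the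
vector bundles with fibres `EE x` and `VV g`. The bundle projections commute with all structure
maps, and the multiplications by scalars `r ≥ 0` form a groupoid morphism (compatibility with
inversion follows). -/
structure VBGroupoid {EM EG : Type*}
    [NormedAddCommGroup EM] [NormedSpace ℝ EM] [NormedAddCommGroup EG] [NormedSpace ℝ EG]
    {M : Type u} [TopologicalSpace M] [ChartedSpace EM M]
    {G : Type u} [TopologicalSpace G] [ChartedSpace EG G]
    (𝒢 : LieGroupoid 𝓘(ℝ, EM) M 𝓘(ℝ, EG) G)
    (FE : Type*) [NormedAddCommGroup FE] [NormedSpace ℝ FE]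
    (EE : M → Type u) [∀ x, AddCommGroup (EE x)] [∀ x, Module ℝ (EE x)]
    [∀ x, TopologicalSpace (EE x)] [TopologicalSpace (TotalSpace FE EE)] [FiberBundle FE EE]
    (FV : Type*) [NormedAddCommGroup FV] [NormedSpace ℝ FV]
    (VV : G → Type u) [∀ g, AddCommGroup (VV g)] [∀ g, Module ℝ (VV g)]
    [∀ g, TopologicalSpace (VV g)] [TopologicalSpace (TotalSpace FV VV)] [FiberBundle FV VV]
    extends LieGroupoid (𝓘(ℝ, EM).prod 𝓘(ℝ, FE)) (TotalSpace FE EE)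
      (𝓘(ℝ, EG).prod 𝓘(ℝ, FV)) (TotalSpace FV VV) where
  proj_src : ∀ ξ, (src ξ).proj = 𝒢.src ξ.proj
  proj_tgt : ∀ ξ, (tgt ξ).proj = 𝒢.tgt ξ.proj
  proj_one : ∀ e, (one e).proj = 𝒢.one e.proj
  proj_mul : ∀ ξ η, src ξ = tgt η → (mul ξ η).proj = 𝒢.mul ξ.proj η.proj
  src_scale : ∀ r : ℝ, 0 ≤ r → ∀ ξ, src (fibreScale FV r ξ) = fibreScale FE r (src ξ)
  tgt_scale : ∀ r : ℝ, 0 ≤ r → ∀ ξ, tgt (fibreScale FV r ξ) = fibreScale FE r (tgt ξ)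
  one_scale : ∀ r : ℝ, 0 ≤ r → ∀ e, one (fibreScale FE r e) = fibreScale FV r (one e)
  mul_scale : ∀ r : ℝ, 0 ≤ r → ∀ ξ η, src ξ = tgt η →
    mul (fibreScale FV r ξ) (fibreScale FV r η) = fibreScale FV r (mul ξ η)

namespace VBGroupoid

variable {EM EG : Type*}
  [NormedAddCommGroup EM] [NormedSpace ℝ EM] [NormedAddCommGroup EG] [NormedSpace ℝ EG]
  {M : Type u} [TopologicalSpace M] [ChartedSpace EM M]
  {G : Type u} [TopologicalSpace G] [ChartedSpace EG G]
  {𝒢 : LieGroupoid 𝓘(ℝ, EM) M 𝓘(ℝ, EG) G}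
  {FE : Type*} [NormedAddCommGroup FE] [NormedSpace ℝ FE]
  {EE : M → Type u} [∀ x, AddCommGroup (EE x)] [∀ x, Module ℝ (EE x)]
  [∀ x, TopologicalSpace (EE x)] [TopologicalSpace (TotalSpace FE EE)] [FiberBundle FE EE]
  {FV : Type*} [NormedAddCommGroup FV] [NormedSpace ℝ FV]
  {VV : G → Type u} [∀ g, AddCommGroup (VV g)] [∀ g, Module ℝ (VV g)]
  [∀ g, TopologicalSpace (VV g)] [TopologicalSpace (TotalSpace FV VV)] [FiberBundle FV VV]

/-- The homogeneous structure of the vector bundle `B_p 𝒱 → B_p 𝒢`. -/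
def nerveScale (𝒱 : VBGroupoid 𝒢 FE EE FV VV) (r : ℝ) (hr : 0 ≤ r) :
    (n : ℕ) → 𝒱.Nerve n → 𝒱.Nerve n
  | 0, e => fibreScale FE (W := EE) r e
  | _ + 1, ξ => ⟨fun i => fibreScale FV r (ξ.1 i), fun i => by
      rw [𝒱.src_scale r hr, 𝒱.tgt_scale r hr, ξ.2 i]⟩

/-- `φ (r ξ) = r φ(ξ)` for all `r ≥ 0`. -/
def IsOneHomogeneous (𝒱 : VBGroupoid 𝒢 FE EE FV VV) (n : ℕ) (φ : 𝒱.Nerve n → ℝ) : Prop :=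
  ∀ (r : ℝ) (hr : 0 ≤ r) (ξ : 𝒱.Nerve n), φ (𝒱.nerveScale r hr n ξ) = r * φ ξ

/-- `φ (0_g, ξ_2, …, ξ_p) = 0`. -/
def VanishesOnZero (𝒱 : VBGroupoid 𝒢 FE EE FV VV) : (n : ℕ) → (𝒱.Nerve n → ℝ) → Prop
  | 0, _ => True
  | n + 1, φ => ∀ (g : G) (ξ : 𝒱.Nerve (n + 1)), ξ.1 0 = zeroSection FV VV g → φ ξ = 0

/-- `φ (0_g · ξ_1, ξ_2, …, ξ_p) = φ (ξ_1, ξ_2, …, ξ_p)` whenever `0_g` and `ξ_1` are composable. -/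
def IsLeftInvariant (𝒱 : VBGroupoid 𝒢 FE EE FV VV) : (n : ℕ) → (𝒱.Nerve n → ℝ) → Prop
  | 0, _ => True
  | n + 1, φ => ∀ (g : G) (ξ η : 𝒱.Nerve (n + 1)),
      𝒱.src (zeroSection FV VV g) = 𝒱.tgt (ξ.1 0) →
      η.1 0 = 𝒱.mul (zeroSection FV VV g) (ξ.1 0) →
      (∀ i : Fin n, η.1 i.succ = ξ.1 i.succ) → φ η = φ ξ

/-- The space `C^p_VB(𝒱)` of VB-groupoid cochains: the smooth, normalized, fibrewise 1-homogeneous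
functions on `B_p 𝒱` with the two conditions above. -/
def cochains (𝒱 : VBGroupoid 𝒢 FE EE FV VV) (n : ℕ) : Submodule ℝ (𝒱.Nerve n → ℝ) where
  carrier := {φ | 𝒱.IsSmooth n φ ∧ 𝒱.IsNormalized n φ ∧ 𝒱.IsOneHomogeneous n φ ∧
    𝒱.VanishesOnZero n φ ∧ 𝒱.IsLeftInvariant n φ}
  zero_mem' := by
    refine ⟨?_, ?_, fun r hr ξ => by simp, ?_, ?_⟩ <;> cases n
    · exact contMDiff_const
    · exact ⟨fun _ => 0, contMDiffOn_const, fun _ => rfl⟩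
    · trivial
    · exact fun _ _ => rfl
    · trivial
    · exact fun _ _ _ => rfl
    · trivial
    · exact fun _ _ _ _ _ _ => rfl
  add_mem' := by
    rintro φ ψ ⟨a1, a2, a3, a4, a5⟩ ⟨b1, b2, b3, b4, b5⟩
    refine ⟨?_, ?_, fun r hr ξ => by simp [a3 r hr ξ, b3 r hr ξ, mul_add], ?_, ?_⟩ <;> cases n
    · exact ContMDiff.add (M := TotalSpace FE EE) a1 b1
    · obtain ⟨A, hA, hA'⟩ := a1
      obtain ⟨B, hB, hB'⟩ := b1
      exact ⟨fun g => A g + B g, hA.add hB, fun g => by simp [hA', hB']⟩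
    · trivial
    · exact fun g h => by simp [a2 g h, b2 g h]
    · trivial
    · exact fun g ξ h => by simp [a4 g ξ h, b4 g ξ h]
    · trivial
    · exact fun g ξ η h h' h'' => by simp [a5 g ξ η h h' h'', b5 g ξ η h h' h'']
  smul_mem' := by
    rintro r φ ⟨a1, a2, a3, a4, a5⟩
    refine ⟨?_, ?_, fun q hq ξ => by simp [a3 q hq ξ, mul_left_comm], ?_, ?_⟩ <;> cases n
    · have key : ∀ ψ : TotalSpace FE EE → ℝ,
          ContMDiff (𝓘(ℝ, EM).prod 𝓘(ℝ, FE)) 𝓘(ℝ, ℝ) ∞ ψ →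
          ContMDiff (𝓘(ℝ, EM).prod 𝓘(ℝ, FE)) 𝓘(ℝ, ℝ) ∞ (fun e => r * ψ e) :=
        fun ψ hψ => contMDiff_const.mul hψ
      exact key φ a1
    · obtain ⟨A, hA, hA'⟩ := a1
      exact ⟨fun ζ => r * A ζ, contMDiffOn_const.mul hA, fun g => by simp [hA']⟩
    · trivial
    · exact fun g h => by simp [a2 g h]
    · trivial
    · exact fun g ξ h => by simp [a4 g ξ h]
    · trivial
    · exact fun g ξ η h h' h'' => by simp [a5 g ξ η h h' h'']

/-- The cocycles of `(C^•_VB(𝒱), δ)`. -/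
def cocycles (𝒱 : VBGroupoid 𝒢 FE EE FV VV) (n : ℕ) : Submodule ℝ (𝒱.Nerve n → ℝ) :=
  𝒱.cochains n ⊓ LinearMap.ker (𝒱.delta n)

/-- The coboundaries of `(C^•_VB(𝒱), δ)`. -/
def coboundaries (𝒱 : VBGroupoid 𝒢 FE EE FV VV) : (n : ℕ) → Submodule ℝ (𝒱.Nerve n → ℝ)
  | 0 => ⊥
  | n + 1 => (𝒱.cochains n).map (𝒱.delta n)

/-- The VB-groupoid cohomology `H^p(C^•_VB(𝒱))`. -/
abbrev cohomology (𝒱 : VBGroupoid 𝒢 FE EE FV VV) (n : ℕ) : Type _ :=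
  𝒱.cocycles n ⧸ (𝒱.coboundaries n).submoduleOf (𝒱.cocycles n)

end VBGroupoid

end

-- A smooth function on a vector space that is 1-homogeneous for nonnegative scalars equals its
-- derivative at zero (`eq_fderiv_of_homogeneous`), so a cochain is linear on the composable strings
-- over a fixed string of arrows. Two strings with the same first vector over the same arrows differ
-- by a string that begins with a zero vector, where condition 1 makes the cochain vanish. Hence a
-- cochain depends only on its first vector and on the base points of the other entries
-- (`cochain_eq_of_proj_eq`). In degree `n + 2` the last entry is not the first one, so `φ(ξ, η)` is
-- a function of `ξ` and of the arrow `h` below `η` (`lastEval`). It can therefore be averaged over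
-- a target fibre of `𝒢`; no measure on `𝒱` is needed.
--
-- Evaluate `δφ = 0` on `(ξ, η)` and average over `h`. The last face gives `φ(ξ)`. The face before
-- it multiplies `h` by the last base arrow `g`, and by left invariance it averages to the last face
-- term of `δ` of the average. The remaining faces do not touch `η` and average to the other terms.
-- So `δ` of the average is `φ` up to sign (`delta_averageLast`). It remains to see that the average
-- is again a cochain (`averageLast_mem_cochains`), where the analytic point is smoothness.
--
-- The smoothness axiom of a Haar system concerns one compactly supported function on `G`, without
-- parameters. The averages are therefore built from another left invariant density, obtained on any
-- Lie groupoid by transporting a positive density along the units by left translations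
-- (`weight_mul`, `integral_mul_left`); it is smooth in charts, so its integrals depend smoothly on
-- parameters. The hypothesis of the theorem serves only to provide a nonnegative function on `M`
-- that localizes these integrals (`IsFibreCutoff`): the square of a given cut-off function, or, for
-- proper `𝒢`, a sum built from a compact exhaustion. Smoothness of the averaged cochain then
-- follows from local smooth lifts against the target map of `𝒱` (`exists_local_lift`) and local
-- parametrizations of the composable strings (`exists_parametrization`).

universe w w'

noncomputable section

/-! ### Calculus preliminaries: products, homogeneous functions, integrals with parameters -/

section PiManifold

variable {ι : Type*} [Fintype ι] {E H : ι → Type*}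
  [∀ i, NormedAddCommGroup (E i)] [∀ i, NormedSpace ℝ (E i)] [∀ i, TopologicalSpace (H i)]
  {J : ∀ i, ModelWithCorners ℝ (E i) (H i)} {M : ι → Type*}
  [∀ i, TopologicalSpace (M i)] [∀ i, ChartedSpace (H i) (M i)]
  {E' H' N : Type*} [NormedAddCommGroup E'] [NormedSpace ℝ E'] [TopologicalSpace H']
  {I : ModelWithCorners ℝ E' H'} [TopologicalSpace N] [ChartedSpace H' N] {n : WithTop ℕ∞}

/-- A map into a finite product of manifolds is smooth if and only if its components are. -/
theorem contMDiffWithinAt_pi_iff {f : N → ∀ i, M i} {s : Set N} {x : N} :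
    ContMDiffWithinAt I (ModelWithCorners.pi J) n f s x ↔
      ∀ i, ContMDiffWithinAt I (J i) n (fun x => f x i) s x := by
  simp only [contMDiffWithinAt_iff, continuousWithinAt_pi, forall_and]
  refine and_congr_right fun _ => ?_
  rw [contDiffWithinAt_pi]
  rfl

theorem contMDiffAt_pi_iff {f : N → ∀ i, M i} {x : N} :
    ContMDiffAt I (ModelWithCorners.pi J) n f x ↔
      ∀ i, ContMDiffAt I (J i) n (fun x => f x i) x :=
  contMDiffWithinAt_pi_iff

theorem contMDiffAt_eval (i : ι) (x : ∀ i, M i) :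
    ContMDiffAt (ModelWithCorners.pi J) (J i) n (fun y : ∀ i, M i => y i) x :=
  contMDiffAt_pi_iff.1 (contMDiffAt_id (I := ModelWithCorners.pi J)) i

end PiManifold

/-- A differentiable positively homogeneous function of degree one is linear. -/
theorem eq_fderiv_of_homogeneous {X Z : Type*} [NormedAddCommGroup X] [NormedSpace ℝ X]
    [NormedAddCommGroup Z] [NormedSpace ℝ Z] {f : X → Z} (hf : DifferentiableAt ℝ f 0)
    (hom : ∀ r : ℝ, 0 ≤ r → ∀ x, f (r • x) = r • f x) (x : X) : f x = fderiv ℝ f 0 x := by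
  have h0 : f 0 = 0 := by simpa using hom 0 le_rfl 0
  have h1 : HasDerivAt (fun r : ℝ => f (r • x)) (fderiv ℝ f 0 x) 0 := by
    have hs : HasDerivAt (fun r : ℝ => r • x) x 0 := by
      simpa using (hasDerivAt_id (0 : ℝ)).smul_const x
    have hf' : HasFDerivAt f (fderiv ℝ f 0) ((0 : ℝ) • x) := by simpa using hf.hasFDerivAt
    exact hf'.comp_hasDerivAt (0 : ℝ) hs
  -- Homogeneity is known for `r ≥ 0` only, so the two derivatives of `r ↦ f (r • x)` are compared
  -- from the right.
  have h2 : HasDerivWithinAt (fun r : ℝ => f (r • x)) (f x) (Set.Ici 0) 0 := by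
    have : HasDerivWithinAt (fun r : ℝ => r • f x) (f x) (Set.Ici 0) 0 := by
      simpa using ((hasDerivAt_id (0 : ℝ)).smul_const (f x)).hasDerivWithinAt
    exact this.congr (fun r hr => hom r hr x) (by simp [h0])
  exact (uniqueDiffWithinAt_Ici (0 : ℝ)).eq_deriv _ h2 h1.hasDerivWithinAt

/-- The derivative of a smooth map along a vector space factor is smooth in the parameters. -/
theorem ContMDiffAt.fderiv_param {E H N Y Z : Type*} [NormedAddCommGroup E] [NormedSpace ℝ E]
    [TopologicalSpace H] {I : ModelWithCorners ℝ E H} [TopologicalSpace N] [ChartedSpace H N]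
    [IsManifold I ∞ N]
    [NormedAddCommGroup Y] [NormedSpace ℝ Y] [NormedAddCommGroup Z] [NormedSpace ℝ Z]
    {f : N → Y → Z} {y : N → Y} {n₀ : N}
    (hf : ContMDiffAt (I.prod 𝓘(ℝ, Y)) 𝓘(ℝ, Z) ∞ (fun q : N × Y => f q.1 q.2) (n₀, y n₀))
    (hy : ContMDiffAt I 𝓘(ℝ, Y) ∞ y n₀) :
    ContMDiffAt I 𝓘(ℝ, Y →L[ℝ] Z) ∞ (fun n => fderiv ℝ (f n) (y n)) n₀ := by
  have := ContMDiffAt.mfderiv (n := ∞) (m := ∞) f y hf hy (by simp)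
  simpa [inTangentCoordinates_model_space, mfderiv_eq_fderiv] using this

/-- Integrals of smooth functions, compactly supported uniformly in the parameters, are smooth. -/
theorem contDiffOn_integral_of_compact {P Y : Type*} [NormedAddCommGroup P] [NormedSpace ℝ P]
    [NormedAddCommGroup Y] [NormedSpace ℝ Y] [FiniteDimensional ℝ Y] [MeasurableSpace Y]
    [BorelSpace Y] (ν : Measure Y) [ν.IsAddHaarMeasure] {g : P → Y → ℝ} {s : Set P} {k : Set Y}
    (hs : IsOpen s) (hk : IsCompact k) (hg0 : ∀ p y, p ∈ s → y ∉ k → g p y = 0)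
    (hg : ContDiffOn ℝ ∞ (fun q : P × Y => g q.1 q.2) (s ×ˢ Set.univ)) :
    ContDiffOn ℝ ∞ (fun p => ∫ y, g p y ∂ν) s := by
  -- The integral is the convolution of the constant `1` with `g p`, evaluated at `0`, up to the
  -- reflection `y ↦ -y`.
  have h := contDiffOn_convolution_right_with_param_comp (μ := ν) (n := ⊤)
    (ContinuousLinearMap.mul ℝ ℝ) (v := fun _ : P => (0 : Y)) contDiffOn_const
    (f := fun _ => 1) hs hk hg0 (locallyIntegrable_const 1) hg
  refine h.congr fun p _ => ?_
  simp [convolution, integral_neg_eq_self (fun y => g p y) ν]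

/-! ### Fibre charts of submersions -/

section FibreChart

variable {E H E' H' Y : Type*}
  [NormedAddCommGroup E] [NormedSpace ℝ E] [TopologicalSpace H]
  [NormedAddCommGroup E'] [NormedSpace ℝ E'] [TopologicalSpace H']
  [NormedAddCommGroup Y] [NormedSpace ℝ Y]

/-- A chart of the total space of a submersion `f : N → N'` in which `f` is the first projection
`N' × Y → N'`. -/
structure IsFibreChart (I : ModelWithCorners ℝ E H) (J : ModelWithCorners ℝ E' H')
    {N : Type*} [TopologicalSpace N] [ChartedSpace H N]
    {N' : Type*} [TopologicalSpace N'] [ChartedSpace H' N'] (f : N → N')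
    (e : OpenPartialHomeomorph N (N' × Y)) : Prop where
  fst_apply : ∀ n ∈ e.source, (e n).1 = f n
  contMDiffOn : ContMDiffOn I (J.prod 𝓘(ℝ, Y)) ∞ e e.source
  contMDiffOn_symm : ContMDiffOn (J.prod 𝓘(ℝ, Y)) I ∞ e.symm e.target

variable {I : ModelWithCorners ℝ E H} {J : ModelWithCorners ℝ E' H'}
  {N : Type*} [TopologicalSpace N] [ChartedSpace H N]
  {N' : Type*} [TopologicalSpace N'] [ChartedSpace H' N'] {f : N → N'}

namespace IsFibreChart

variable {e : OpenPartialHomeomorph N (N' × Y)}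

theorem contMDiffAt (he : IsFibreChart I J f e) {n : N} (hn : n ∈ e.source) :
    ContMDiffAt I (J.prod 𝓘(ℝ, Y)) ∞ e n :=
  he.contMDiffOn.contMDiffAt (e.open_source.mem_nhds hn)

theorem contMDiffAt_symm (he : IsFibreChart I J f e) {q : N' × Y} (hq : q ∈ e.target) :
    ContMDiffAt (J.prod 𝓘(ℝ, Y)) I ∞ e.symm q :=
  he.contMDiffOn_symm.contMDiffAt (e.open_target.mem_nhds hq)

theorem apply_symm (he : IsFibreChart I J f e) {q : N' × Y} (hq : q ∈ e.target) :
    f (e.symm q) = q.1 := by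
  rw [← he.fst_apply _ (e.map_target hq), e.right_inv hq]

theorem mk_snd (he : IsFibreChart I J f e) {n : N} (hn : n ∈ e.source) : (f n, (e n).2) = e n :=
  Prod.ext (he.fst_apply n hn).symm rfl

theorem mem_target (he : IsFibreChart I J f e) {n : N} (hn : n ∈ e.source) :
    (f n, (e n).2) ∈ e.target := by
  rw [he.mk_snd hn]
  exact e.map_source hn

theorem symm_mk_snd (he : IsFibreChart I J f e) {n : N} (hn : n ∈ e.source) :
    e.symm (f n, (e n).2) = n := by
  rw [he.mk_snd hn, e.left_inv hn]

theorem restrOpen (he : IsFibreChart I J f e) {s : Set N} (hs : IsOpen s) :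
    IsFibreChart I J f (e.restrOpen s hs) where
  fst_apply n hn := he.fst_apply n hn.1
  contMDiffOn := he.contMDiffOn.mono fun _ hn => hn.1
  contMDiffOn_symm := he.contMDiffOn_symm.mono fun _ hn => hn.1

end IsFibreChart

/-- In suitable charts a submersion is a linear projection. Undoing the chart of the base alone
keeps the point `f n` itself as first component, so that whole fibres become slices with coordinate
in `Y`. -/
theorem Manifold.IsSubmersionAtOfComplement.exists_isFibreChart [I.Boundaryless]
    {n : N} (hf : Manifold.IsSubmersionAtOfComplement Y I J ∞ f n) :
    ∃ e : OpenPartialHomeomorph N (N' × Y), IsFibreChart I J f e ∧ n ∈ e.source := by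
  classical
  obtain ⟨a, b, q, hna, ha, hb, hab, hfs, hw⟩ :
      ∃ (a : OpenPartialHomeomorph N H) (b : OpenPartialHomeomorph N' H') (q : E ≃L[ℝ] (E' × Y)),
        n ∈ a.source ∧ a ∈ IsManifold.maximalAtlas I ∞ N ∧ b ∈ IsManifold.maximalAtlas J ∞ N' ∧
        (∀ m ∈ a.source, f m ∈ b.source) ∧ ContMDiffOn I J ∞ f a.source ∧
        ∀ z ∈ (a.extend I).target, b.extend J (f ((a.extend I).symm z)) = (q z).1 :=
    ⟨hf.domChart, hf.codChart, hf.equiv, hf.mem_domChart_source, hf.domChart_mem_maximalAtlas,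
      hf.codChart_mem_maximalAtlas, fun _ hm => hf.source_subset_preimage_source hm,
      hf.contMDiffOn, fun _ hz => hf.writtenInCharts hz⟩
  have hcoord : ∀ m ∈ a.source, b.extend J (f m) = (q (a.extend I m)).1 := by
    intro m hm
    have h := hw _ ((a.extend I).map_source (by simpa using hm))
    rwa [a.extend_left_inv hm] at h
  have htgt : IsOpen (a.extend I).target := a.isOpen_extend_target
  have hinv : ContMDiffOn (J.prod 𝓘(ℝ, Y)) 𝓘(ℝ, E) ∞
      (fun z : N' × Y => q.symm (b.extend J z.1, z.2)) (b.source ×ˢ Set.univ) := by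
    refine q.symm.contDiff.contMDiff.comp_contMDiffOn ?_
    refine ContMDiffOn.prodMk_space ?_ contMDiff_snd.contMDiffOn
    exact (b.contMDiffOn_extend hb).comp contMDiff_fst.contMDiffOn fun z hz => hz.1
  -- The pairs whose coordinates come from a point of the chart `a`; the target of the fibre chart
  -- need not be a product.
  let D : Set (N' × Y) := (b.source ×ˢ Set.univ) ∩
    (fun z : N' × Y => q.symm (b.extend J z.1, z.2)) ⁻¹' (a.extend I).target
  have hD : IsOpen D := hinv.continuousOn.isOpen_inter_preimage
    (b.open_source.prod isOpen_univ) htgt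
  have hfwd : ContMDiffOn I (J.prod 𝓘(ℝ, Y)) ∞ (fun m => (f m, (q (a.extend I m)).2)) a.source := by
    refine hfs.prodMk ?_
    exact ((ContinuousLinearMap.snd ℝ E' Y).contDiff.comp q.contDiff).contMDiff.comp_contMDiffOn
      (a.contMDiffOn_extend ha)
  have hbwd : ContMDiffOn (J.prod 𝓘(ℝ, Y)) I ∞
      (fun z : N' × Y => (a.extend I).symm (q.symm (b.extend J z.1, z.2))) D := by
    refine (contMDiffOn_extend_symm ha).comp (hinv.mono fun z hz => hz.1) fun z hz => ?_
    have := hz.2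
    rw [Set.mem_preimage, a.extend_target'] at this
    exact this
  have hmem : ∀ z ∈ D, (a.extend I).symm (q.symm (b.extend J z.1, z.2)) ∈ a.source := by
    intro z hz
    simpa using (a.extend I).map_target hz.2
  refine ⟨{ toFun := fun m => (f m, (q (a.extend I m)).2)
            invFun := fun z => (a.extend I).symm (q.symm (b.extend J z.1, z.2))
            source := a.source
            target := D
            map_source' := ?_
            map_target' := hmem
            left_inv' := ?_
            right_inv' := ?_
            open_source := a.open_source
            open_target := hD
            continuousOn_toFun := hfwd.continuousOn
            continuousOn_invFun := hbwd.continuousOn }, ⟨fun _ _ => rfl, hfwd, hbwd⟩,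
          hna⟩
  · intro m hm
    refine ⟨⟨hab m hm, trivial⟩, ?_⟩
    have : q.symm (b.extend J (f m), (q (a.extend I m)).2) = a.extend I m := by
      rw [hcoord m hm]; exact q.symm_apply_apply _
    simp only [Set.mem_preimage, this]
    exact (a.extend I).map_source (by simpa using hm)
  · intro m hm
    have : q.symm (b.extend J (f m), (q (a.extend I m)).2) = a.extend I m := by
      rw [hcoord m hm]; exact q.symm_apply_apply _
    simp only [this, a.extend_left_inv hm]
  · intro z hz
    have h1 := hmem z hz
    have h2 : a.extend I ((a.extend I).symm (q.symm (b.extend J z.1, z.2))) =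
      q.symm (b.extend J z.1, z.2) := (a.extend I).right_inv hz.2
    refine Prod.ext ?_ (by simp only [h2, q.apply_symm_apply])
    have h3 := hcoord _ h1
    rw [h2, q.apply_symm_apply] at h3
    have hi : Set.InjOn (b.extend J) b.source := by
      simpa using (b.extend J).injOn
    exact hi (hab _ h1) hz.1.1 h3

end FibreChart

/-! ### Left translations in fibre coordinates and their Jacobians -/

theorem ContinuousLinearMap.det_comp' {Y : Type*} [NormedAddCommGroup Y] [NormedSpace ℝ Y]
    (S T : Y →L[ℝ] Y) : (S.comp T).det = S.det * T.det :=
  LinearMap.det_comp (S : Y →ₗ[ℝ] Y) (T : Y →ₗ[ℝ] Y)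

/-- In a basis the determinant is the Leibniz polynomial in the matrix entries, which are linear in
`T`. -/
theorem ContinuousLinearMap.contDiff_det {Y : Type*} [NormedAddCommGroup Y] [NormedSpace ℝ Y]
    [FiniteDimensional ℝ Y] {n : WithTop ℕ∞} : ContDiff ℝ n (fun T : Y →L[ℝ] Y => T.det) := by
  classical
  let b := Module.finBasis ℝ Y
  have h : ∀ T : Y →L[ℝ] Y, T.det = (LinearMap.toMatrix b b (T : Y →ₗ[ℝ] Y)).det := fun T =>
    (LinearMap.det_toMatrix b _).symm
  simp only [h, Matrix.det_apply]
  refine ContDiff.sum fun σ _ => ContDiff.const_smul _ (contDiff_prod fun i _ => ?_)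
  simp only [LinearMap.toMatrix_apply]
  have h2 : ContDiff ℝ n (fun T : Y →L[ℝ] Y => T (b i)) := contDiff_id.clm_apply contDiff_const
  exact (LinearMap.toContinuousLinearMap (b.coord (σ i))).contDiff.comp h2

namespace LieGroupoid

section Algebra

variable {EM HM EG HG : Type*}
  [NormedAddCommGroup EM] [NormedSpace ℝ EM] [TopologicalSpace HM]
  [NormedAddCommGroup EG] [NormedSpace ℝ EG] [TopologicalSpace HG]
  {J : ModelWithCorners ℝ EM HM} {M : Type*} [TopologicalSpace M] [ChartedSpace HM M]
  {I : ModelWithCorners ℝ EG HG} {G : Type*} [TopologicalSpace G] [ChartedSpace HG G]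
  (𝒢 : LieGroupoid J M I G)

theorem inv_mul_cancel_left' {g h : G} (hgh : 𝒢.src g = 𝒢.tgt h) :
    𝒢.mul (𝒢.inv g) (𝒢.mul g h) = h := by
  rw [← 𝒢.mul_assoc _ _ _ (𝒢.src_inv g) hgh, 𝒢.inv_mul, hgh, 𝒢.one_mul]

theorem inv_mul_mul_eq {g h : G} (hgh : 𝒢.src g = 𝒢.tgt h) :
    𝒢.mul (𝒢.inv (𝒢.mul g h)) g = 𝒢.inv h := by
  have h1 : 𝒢.src (𝒢.inv (𝒢.mul g h)) = 𝒢.tgt g := by rw [𝒢.src_inv, 𝒢.tgt_mul _ _ hgh]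
  have h2 : 𝒢.src (𝒢.mul (𝒢.inv (𝒢.mul g h)) g) = 𝒢.tgt h := by rw [𝒢.src_mul _ _ h1, hgh]
  have h3 := 𝒢.mul_one (𝒢.mul (𝒢.inv (𝒢.mul g h)) g)
  rw [h2, ← 𝒢.mul_inv, ← 𝒢.mul_assoc _ _ _ h2 (𝒢.tgt_inv h).symm,
    𝒢.mul_assoc _ _ _ h1 hgh, 𝒢.inv_mul, 𝒢.src_mul _ _ hgh, ← 𝒢.tgt_inv h, 𝒢.one_mul] at h3
  exact h3.symm

end Algebra

section FibreIntegral

variable {EM EG Y : Type*}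
  [NormedAddCommGroup EM] [NormedSpace ℝ EM]
  [NormedAddCommGroup EG] [NormedSpace ℝ EG]
  [NormedAddCommGroup Y] [NormedSpace ℝ Y]
  {M : Type*} [TopologicalSpace M] [ChartedSpace EM M]
  {G : Type*} [TopologicalSpace G] [ChartedSpace EG G]
  (𝒢 : LieGroupoid 𝓘(ℝ, EM) M 𝓘(ℝ, EG) G)

theorem continuous_src : Continuous 𝒢.src := 𝒢.isSubmersion_src.contMDiff.continuous

theorem continuous_tgt : Continuous 𝒢.tgt := 𝒢.isSubmersion_tgt.contMDiff.continuous

theorem continuousOn_mul_left (g : G) : ContinuousOn (𝒢.mul g) {h | 𝒢.tgt h = 𝒢.src g} :=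
  𝒢.contMDiffOn_mul.continuousOn.comp (f := fun h => (g, h))
    (Continuous.prodMk_right g).continuousOn fun _ hh => Eq.symm hh

/-- A chart of `G` adapted to the target map. -/
abbrev IsTgtChart (e : OpenPartialHomeomorph G (M × Y)) : Prop :=
  IsFibreChart 𝓘(ℝ, EG) 𝓘(ℝ, EM) 𝒢.tgt e

/-- Left translation by `g`, from the fibre over `src g` to the fibre over `tgt g`, in the fibre
coordinates of two charts. -/
def leftTrans (e e' : OpenPartialHomeomorph G (M × Y)) (g : G) (y : Y) : Y :=
  (e' (𝒢.mul g (e.symm (𝒢.src g, y)))).2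

/-- The domain of definition of `leftTrans`. -/
def leftTransDom (e e' : OpenPartialHomeomorph G (M × Y)) (g : G) : Set Y :=
  {y | (𝒢.src g, y) ∈ e.target ∧ 𝒢.mul g (e.symm (𝒢.src g, y)) ∈ e'.source}

variable {𝒢} {e e' e'' : OpenPartialHomeomorph G (M × Y)}

/-- Multiplication is smooth only along the composable pairs. A fibre chart parametrizes the arrows
composable with `g` by a coordinate `y`, which turns the product into a smooth map on an open set of
pairs `(g, y)`. -/
theorem contMDiffOn_mul_symm (he : 𝒢.IsTgtChart e) :
    ContMDiffOn (𝓘(ℝ, EG).prod 𝓘(ℝ, Y)) 𝓘(ℝ, EG) ∞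
      (fun q : G × Y => 𝒢.mul q.1 (e.symm (𝒢.src q.1, q.2)))
      ((fun q : G × Y => (𝒢.src q.1, q.2)) ⁻¹' e.target) := by
  refine 𝒢.contMDiffOn_mul.comp (t := {q | 𝒢.src q.1 = 𝒢.tgt q.2})
    (f := fun q : G × Y => (q.1, e.symm (𝒢.src q.1, q.2))) ?_ ?_
  · refine contMDiff_fst.contMDiffOn.prodMk ?_
    refine he.contMDiffOn_symm.comp (ContMDiff.contMDiffOn ?_) fun q hq => hq
    exact (𝒢.isSubmersion_src.contMDiff.comp contMDiff_fst).prodMk contMDiff_snd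
  · intro q hq
    exact (he.apply_symm hq).symm

theorem isOpen_preimage_target (e : OpenPartialHomeomorph G (M × Y)) :
    IsOpen ((fun q : G × Y => (𝒢.src q.1, q.2)) ⁻¹' e.target) :=
  e.open_target.preimage ((𝒢.continuous_src.comp continuous_fst).prodMk continuous_snd)

theorem contMDiffAt_leftTrans (he : 𝒢.IsTgtChart e) (he' : 𝒢.IsTgtChart e') {g : G} {y : Y}
    (hy : y ∈ 𝒢.leftTransDom e e' g) :
    ContMDiffAt (𝓘(ℝ, EG).prod 𝓘(ℝ, Y)) 𝓘(ℝ, Y) ∞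
      (fun q : G × Y => 𝒢.leftTrans e e' q.1 q.2) (g, y) := by
  have h1 := (contMDiffOn_mul_symm he).contMDiffAt
    ((isOpen_preimage_target e).mem_nhds (x := (g, y)) hy.1)
  exact contMDiffAt_snd.comp _
    (ContMDiffAt.comp (g, y) (g := e') (he'.contMDiffAt (n := 𝒢.mul g (e.symm (𝒢.src g, y))) hy.2) h1)

theorem contDiffAt_leftTrans (he : 𝒢.IsTgtChart e) (he' : 𝒢.IsTgtChart e') {g : G} {y : Y}
    (hy : y ∈ 𝒢.leftTransDom e e' g) : ContDiffAt ℝ ∞ (𝒢.leftTrans e e' g) y := by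
  refine ContMDiffAt.contDiffAt ?_
  exact (contMDiffAt_leftTrans he he' hy).comp y (f := fun y => (g, y))
    (contMDiffAt_const.prodMk contMDiffAt_id)

theorem differentiableAt_leftTrans (he : 𝒢.IsTgtChart e) (he' : 𝒢.IsTgtChart e') {g : G} {y : Y}
    (hy : y ∈ 𝒢.leftTransDom e e' g) : DifferentiableAt ℝ (𝒢.leftTrans e e' g) y :=
  (contDiffAt_leftTrans he he' hy).differentiableAt (by simp)

theorem isOpen_leftTransDom (he : 𝒢.IsTgtChart e) (g : G) : IsOpen (𝒢.leftTransDom e e' g) := by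
  have h := (contMDiffOn_mul_symm he).continuousOn.isOpen_inter_preimage
    (isOpen_preimage_target e) e'.open_source
  exact h.preimage (Continuous.prodMk_right g)

theorem symm_leftTrans (he : 𝒢.IsTgtChart e) (he' : 𝒢.IsTgtChart e') {g : G} {y : Y}
    (hy : y ∈ 𝒢.leftTransDom e e' g) :
    e'.symm (𝒢.tgt g, 𝒢.leftTrans e e' g y) = 𝒢.mul g (e.symm (𝒢.src g, y)) := by
  have h := he'.symm_mk_snd hy.2
  rwa [𝒢.tgt_mul _ _ (he.apply_symm hy.1).symm] at h

theorem mem_target_leftTrans (he : 𝒢.IsTgtChart e) (he' : 𝒢.IsTgtChart e') {g : G} {y : Y}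
    (hy : y ∈ 𝒢.leftTransDom e e' g) : (𝒢.tgt g, 𝒢.leftTrans e e' g y) ∈ e'.target := by
  have h := he'.mem_target hy.2
  rwa [𝒢.tgt_mul _ _ (he.apply_symm hy.1).symm] at h

theorem leftTrans_mul (he : 𝒢.IsTgtChart e) (he' : 𝒢.IsTgtChart e') {g k : G} {y : Y}
    (hkg : 𝒢.src k = 𝒢.tgt g) (hy : y ∈ 𝒢.leftTransDom e e' g) :
    𝒢.leftTrans e e'' (𝒢.mul k g) y = 𝒢.leftTrans e' e'' k (𝒢.leftTrans e e' g y) := by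
  simp only [leftTrans]
  rw [show (e' (𝒢.mul g (e.symm (𝒢.src g, y)))).2 = 𝒢.leftTrans e e' g y from rfl, hkg,
    symm_leftTrans he he' hy, 𝒢.src_mul _ _ hkg, 𝒢.mul_assoc _ _ _ hkg (he.apply_symm hy.1).symm]

theorem leftTrans_mem_dom (he : 𝒢.IsTgtChart e) (he' : 𝒢.IsTgtChart e') {g : G} {y : Y}
    (hy : y ∈ 𝒢.leftTransDom e e' g) :
    𝒢.leftTrans e e' g y ∈ 𝒢.leftTransDom e' e (𝒢.inv g) := by
  refine ⟨?_, ?_⟩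
  · rw [𝒢.src_inv]; exact mem_target_leftTrans he he' hy
  · rw [𝒢.src_inv, symm_leftTrans he he' hy, 𝒢.inv_mul_cancel_left' (he.apply_symm hy.1).symm]
    exact e.map_target hy.1

theorem leftTrans_inv_leftTrans (he : 𝒢.IsTgtChart e) (he' : 𝒢.IsTgtChart e') {g : G} {y : Y}
    (hy : y ∈ 𝒢.leftTransDom e e' g) :
    𝒢.leftTrans e' e (𝒢.inv g) (𝒢.leftTrans e e' g y) = y := by
  rw [leftTrans, 𝒢.src_inv, symm_leftTrans he he' hy,
    𝒢.inv_mul_cancel_left' (he.apply_symm hy.1).symm, e.right_inv hy.1]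

variable (𝒢)

theorem inv_inv' (g : G) : 𝒢.inv (𝒢.inv g) = g := by
  have h2 := 𝒢.inv_mul_mul_eq (g := g) (h := 𝒢.inv g) (𝒢.tgt_inv g).symm
  rw [𝒢.mul_inv] at h2
  have h3 : 𝒢.inv (𝒢.one (𝒢.tgt g)) = 𝒢.one (𝒢.tgt g) := by
    have := 𝒢.mul_inv (𝒢.one (𝒢.tgt g))
    have h4 := 𝒢.one_mul (𝒢.inv (𝒢.one (𝒢.tgt g)))
    rw [𝒢.tgt_inv, 𝒢.src_one] at h4
    rw [h4, 𝒢.tgt_one] at this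
    exact this
  rw [h3, 𝒢.one_mul] at h2
  exact h2.symm

variable {𝒢}

theorem image_leftTrans (he : 𝒢.IsTgtChart e) (he' : 𝒢.IsTgtChart e') (g : G) :
    𝒢.leftTrans e e' g '' 𝒢.leftTransDom e e' g = 𝒢.leftTransDom e' e (𝒢.inv g) := by
  refine Set.Subset.antisymm ?_ fun z hz => ?_
  · rintro _ ⟨y, hy, rfl⟩
    exact leftTrans_mem_dom he he' hy
  · refine ⟨𝒢.leftTrans e' e (𝒢.inv g) z, ?_, ?_⟩
    · have := leftTrans_mem_dom he' he hz
      rw [𝒢.inv_inv'] at this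
      exact this
    · have := leftTrans_inv_leftTrans he' he hz
      rw [𝒢.inv_inv'] at this
      exact this

theorem injOn_leftTrans (he : 𝒢.IsTgtChart e) (he' : 𝒢.IsTgtChart e') (g : G) :
    Set.InjOn (𝒢.leftTrans e e' g) (𝒢.leftTransDom e e' g) := by
  intro y hy z hz h
  rw [← leftTrans_inv_leftTrans he he' hy, h, leftTrans_inv_leftTrans he he' hz]

/-- Translation by `g⁻¹` undoes translation by `g` on a neighbourhood, so by the chain rule the two
determinants have product `1`. -/
theorem det_fderiv_leftTrans_ne_zero (he : 𝒢.IsTgtChart e) (he' : 𝒢.IsTgtChart e') {g : G} {y : Y}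
    (hy : y ∈ 𝒢.leftTransDom e e' g) : (fderiv ℝ (𝒢.leftTrans e e' g) y).det ≠ 0 := by
  have h1 := differentiableAt_leftTrans he he' hy
  have h2 := differentiableAt_leftTrans he' he (leftTrans_mem_dom he he' hy)
  have h3 : 𝒢.leftTrans e' e (𝒢.inv g) ∘ 𝒢.leftTrans e e' g =ᶠ[𝓝 y] id := by
    filter_upwards [(isOpen_leftTransDom he g).mem_nhds hy] with z hz
    exact leftTrans_inv_leftTrans he he' hz
  have h4 := h3.fderiv_eq (𝕜 := ℝ)
  rw [fderiv_comp _ h2 h1, fderiv_id] at h4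
  intro h0
  have h5 := congrArg (fun T : Y →L[ℝ] Y => T.det) h4
  simp only [ContinuousLinearMap.det_comp', h0, mul_zero] at h5
  simp [ContinuousLinearMap.det] at h5

variable (𝒢) in
/-- The Jacobian at `h`, in the fibre coordinate of `e`, of the left translation `h⁻¹`, which maps
the fibre through `h` to the fibre through a unit with fibre coordinate from `e'`. -/
def unitJac (e e' : OpenPartialHomeomorph G (M × Y)) (h : G) : ℝ :=
  |(fderiv ℝ (𝒢.leftTrans e e' (𝒢.inv h)) (e h).2).det|

theorem snd_mem_leftTransDom (he : 𝒢.IsTgtChart e) {h : G} (hh : h ∈ e.source) {g : G}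
    (hgh : 𝒢.src g = 𝒢.tgt h) (hg : 𝒢.mul g h ∈ e'.source) :
    (e h).2 ∈ 𝒢.leftTransDom e e' g := by
  refine ⟨?_, ?_⟩
  · rw [hgh]; exact he.mem_target hh
  · rwa [hgh, he.symm_mk_snd hh]

theorem snd_mem_leftTransDom_inv (he : 𝒢.IsTgtChart e) {h : G} (hh : h ∈ e.source)
    (h1 : 𝒢.one (𝒢.src h) ∈ e'.source) : (e h).2 ∈ 𝒢.leftTransDom e e' (𝒢.inv h) :=
  snd_mem_leftTransDom he hh (𝒢.src_inv h) (by rwa [𝒢.inv_mul])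

theorem unitJac_pos (he : 𝒢.IsTgtChart e) (he' : 𝒢.IsTgtChart e') {h : G} (hh : h ∈ e.source)
    (h1 : 𝒢.one (𝒢.src h) ∈ e'.source) : 0 < 𝒢.unitJac e e' h :=
  abs_pos.2 (det_fderiv_leftTrans_ne_zero he he' (snd_mem_leftTransDom_inv he hh h1))

theorem unitJac_mul (he : 𝒢.IsTgtChart e) (he' : 𝒢.IsTgtChart e') (he'' : 𝒢.IsTgtChart e'')
    {g h : G} (hgh : 𝒢.src g = 𝒢.tgt h) (hh : h ∈ e.source) (hg : 𝒢.mul g h ∈ e'.source)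
    (h1 : 𝒢.one (𝒢.src h) ∈ e''.source) :
    𝒢.unitJac e e'' h =
      𝒢.unitJac e' e'' (𝒢.mul g h) * |(fderiv ℝ (𝒢.leftTrans e e' g) (e h).2).det| := by
  have hy := snd_mem_leftTransDom he hh hgh hg
  have hval : 𝒢.leftTrans e e' g (e h).2 = (e' (𝒢.mul g h)).2 := by
    rw [leftTrans, hgh, he.symm_mk_snd hh]
  have hcomp : 𝒢.leftTrans e e'' (𝒢.inv h) =ᶠ[𝓝 (e h).2]
      𝒢.leftTrans e' e'' (𝒢.inv (𝒢.mul g h)) ∘ 𝒢.leftTrans e e' g := by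
    filter_upwards [(isOpen_leftTransDom he g).mem_nhds hy] with z hz
    rw [← 𝒢.inv_mul_mul_eq hgh, leftTrans_mul he he' ?_ hz]
    · rfl
    · rw [𝒢.src_inv, 𝒢.tgt_mul _ _ hgh]
  have h2 : DifferentiableAt ℝ (𝒢.leftTrans e' e'' (𝒢.inv (𝒢.mul g h)))
      (𝒢.leftTrans e e' g (e h).2) := by
    rw [hval]
    exact differentiableAt_leftTrans he' he''
      (snd_mem_leftTransDom_inv he' hg (by rwa [𝒢.src_mul _ _ hgh]))
  rw [unitJac, unitJac, hcomp.fderiv_eq, fderiv_comp _ h2 (differentiableAt_leftTrans he he' hy),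
    hval, ← abs_mul, ContinuousLinearMap.det_comp']

/-- The derivative in the fibre variable is smooth in the parameter `h`, and the absolute value is
smooth where the determinant does not vanish. -/
theorem contMDiffAt_unitJac [FiniteDimensional ℝ Y] [IsManifold 𝓘(ℝ, EG) ∞ G]
    (he : 𝒢.IsTgtChart e) (he' : 𝒢.IsTgtChart e')
    {h : G} (hh : h ∈ e.source) (h1 : 𝒢.one (𝒢.src h) ∈ e'.source) :
    ContMDiffAt 𝓘(ℝ, EG) 𝓘(ℝ, ℝ) ∞ (𝒢.unitJac e e') h := by
  have hy : ContMDiffAt 𝓘(ℝ, EG) 𝓘(ℝ, Y) ∞ (fun h => (e h).2) h :=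
    contMDiffAt_snd.comp _ (he.contMDiffAt hh)
  have h2 : ContMDiffAt (𝓘(ℝ, EG).prod 𝓘(ℝ, Y)) 𝓘(ℝ, Y) ∞
      (fun q : G × Y => 𝒢.leftTrans e e' (𝒢.inv q.1) q.2) (h, (e h).2) :=
    (contMDiffAt_leftTrans he he' (snd_mem_leftTransDom_inv he hh h1)).comp (h, (e h).2)
      (f := fun q : G × Y => (𝒢.inv q.1, q.2))
      ((𝒢.contMDiff_inv.contMDiffAt.comp _ contMDiffAt_fst).prodMk contMDiffAt_snd)
  have h3 := h2.fderiv_param (f := fun h y => 𝒢.leftTrans e e' (𝒢.inv h) y) hy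
  have h4 : ContDiffAt ℝ ∞ (fun T : Y →L[ℝ] Y => |T.det|)
      (fderiv ℝ (𝒢.leftTrans e e' (𝒢.inv h)) (e h).2) :=
    (contDiffAt_abs (det_fderiv_leftTrans_ne_zero he he'
      (snd_mem_leftTransDom_inv he hh h1))).comp _ ContinuousLinearMap.contDiff_det.contDiffAt
  exact ContMDiffAt.comp h (g := fun T : Y →L[ℝ] Y => |T.det|) h4.contMDiffAt h3

end FibreIntegral

end LieGroupoid

/-! ### A smooth left invariant density on the target fibres -/

namespace LieGroupoid

variable {EM EG Y : Type*}
  [NormedAddCommGroup EM] [NormedSpace ℝ EM]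
  [NormedAddCommGroup EG] [NormedSpace ℝ EG]
  [NormedAddCommGroup Y] [NormedSpace ℝ Y]
  {M : Type*} [TopologicalSpace M] [ChartedSpace EM M]
  {G : Type*} [TopologicalSpace G] [ChartedSpace EG G]

/-- A partition of unity of `G` by compactly supported functions subordinate to charts adapted to
the target map. -/
structure TgtAtlas (𝒢 : LieGroupoid 𝓘(ℝ, EM) M 𝓘(ℝ, EG) G) (Y : Type*)
    [NormedAddCommGroup Y] [NormedSpace ℝ Y] where
  chart : G → OpenPartialHomeomorph G (M × Y)
  isTgtChart : ∀ i, 𝒢.IsTgtChart (chart i)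
  part : SmoothPartitionOfUnity G 𝓘(ℝ, EG) G
  isCompact_tsupport : ∀ i, IsCompact (tsupport (part i))
  tsupport_subset : ∀ i, tsupport (part i) ⊆ (chart i).source

theorem exists_tgtAtlas [FiniteDimensional ℝ EG] [T2Space G] [SigmaCompactSpace G]
    [IsManifold 𝓘(ℝ, EG) ∞ G]
    {𝒢 : LieGroupoid 𝓘(ℝ, EM) M 𝓘(ℝ, EG) G}
    (h : Manifold.IsSubmersionOfComplement Y 𝓘(ℝ, EG) 𝓘(ℝ, EM) ∞ 𝒢.tgt) :
    Nonempty (𝒢.TgtAtlas Y) := by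
  have : LocallyCompactSpace G := Manifold.locallyCompact_of_finiteDimensional 𝓘(ℝ, EG)
  choose e he hes using fun g => (h g).exists_isFibreChart
  choose K hK hgK using fun g : G => exists_compact_mem_nhds g
  -- Shrinking the charts into compact sets makes the supports of a subordinate partition compact.
  let e' : G → OpenPartialHomeomorph G (M × Y) :=
    fun g => (e g).restrOpen (interior (K g)) isOpen_interior
  obtain ⟨ρ, hρ⟩ := SmoothPartitionOfUnity.exists_isSubordinate 𝓘(ℝ, EG)
    (s := (Set.univ : Set G)) isClosed_univ (fun g => (e' g).source) (fun g => (e' g).open_source)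
    (fun g _ => Set.mem_iUnion.2 ⟨g, hes g, mem_interior_iff_mem_nhds.2 (hgK g)⟩)
  refine ⟨⟨e', fun g => (he g).restrOpen isOpen_interior, ρ, fun g => ?_, hρ⟩⟩
  exact (hK g).of_isClosed_subset (isClosed_tsupport _)
    fun x hx => interior_subset (hρ g hx).2

namespace TgtAtlas

variable {𝒢 : LieGroupoid 𝓘(ℝ, EM) M 𝓘(ℝ, EG) G} (A : 𝒢.TgtAtlas Y)

/-- The density of the left invariant measures in the fibre coordinate of the chart `e`. -/
def weight (e : OpenPartialHomeomorph G (M × Y)) (h : G) : ℝ :=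
  ∑ᶠ j, A.part j (𝒢.one (𝒢.src h)) * 𝒢.unitJac e (A.chart j) h

variable {e e' : OpenPartialHomeomorph G (M × Y)}

theorem finite_support_part (g : G) : (Function.support fun j => A.part j g).Finite :=
  A.part.locallyFinite.point_finite g

theorem mem_source_of_part_ne_zero {j : G} {g : G} (h : A.part j g ≠ 0) :
    g ∈ (A.chart j).source :=
  A.tsupport_subset j (subset_tsupport _ h)

theorem weight_eq_sum (e : OpenPartialHomeomorph G (M × Y)) (h : G) :
    A.weight e h = ∑ j ∈ (A.finite_support_part (𝒢.one (𝒢.src h))).toFinset,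
      A.part j (𝒢.one (𝒢.src h)) * 𝒢.unitJac e (A.chart j) h := by
  refine finsum_eq_sum_of_support_subset _ fun j hj => ?_
  simp only [Set.Finite.coe_toFinset]
  exact left_ne_zero_of_mul hj

theorem weight_pos (he : 𝒢.IsTgtChart e) {h : G} (hh : h ∈ e.source) : 0 < A.weight e h := by
  rw [weight_eq_sum]
  obtain ⟨i, hi⟩ := A.part.exists_pos_of_mem (Set.mem_univ (𝒢.one (𝒢.src h)))
  refine Finset.sum_pos (fun j hj => ?_) ⟨i, by simpa using hi.ne'⟩
  have hj : A.part j (𝒢.one (𝒢.src h)) ≠ 0 := by simpa using hj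
  exact mul_pos ((A.part.nonneg j _).lt_of_ne' hj)
    (unitJac_pos he (A.isTgtChart j) hh (A.mem_source_of_part_ne_zero hj))

/-- The partition factors depend on `src h = src (gh)` only, so the transformation rule of `unitJac`
passes to the sum. The density at `h` is a fixed density at the unit over `src h`, transported by
left translation. -/
theorem weight_mul (he : 𝒢.IsTgtChart e) (he' : 𝒢.IsTgtChart e') {g h : G}
    (hgh : 𝒢.src g = 𝒢.tgt h) (hh : h ∈ e.source) (hg : 𝒢.mul g h ∈ e'.source) :
    A.weight e h =
      A.weight e' (𝒢.mul g h) * |(fderiv ℝ (𝒢.leftTrans e e' g) (e h).2).det| := by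
  have hs := 𝒢.src_mul _ _ hgh
  rw [weight_eq_sum, weight_eq_sum, Finset.sum_mul]
  simp only [hs]
  refine Finset.sum_congr rfl fun j hj => ?_
  have hj : A.part j (𝒢.one (𝒢.src h)) ≠ 0 := by simpa using hj
  rw [unitJac_mul he he' (A.isTgtChart j) hgh hh hg (A.mem_source_of_part_ne_zero hj),
    _root_.mul_assoc]

theorem contMDiffAt_weight [FiniteDimensional ℝ Y] [IsManifold 𝓘(ℝ, EG) ∞ G]
    (he : 𝒢.IsTgtChart e) {h : G} (hh : h ∈ e.source) :
    ContMDiffAt 𝓘(ℝ, EG) 𝓘(ℝ, ℝ) ∞ (A.weight e) h := by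
  have hone : ContMDiff 𝓘(ℝ, EG) 𝓘(ℝ, EG) ∞ (fun h => 𝒢.one (𝒢.src h)) :=
    𝒢.contMDiff_one.comp 𝒢.isSubmersion_src.contMDiff
  refine contMDiffAt_finsum ?_ fun j => ?_
  · refine (A.part.locallyFinite.preimage_continuous hone.continuous).subset fun j x hx => ?_
    exact left_ne_zero_of_mul hx
  · by_cases hj : 𝒢.one (𝒢.src h) ∈ tsupport (A.part j)
    · refine ContMDiffAt.mul ?_
        (contMDiffAt_unitJac he (A.isTgtChart j) hh (A.tsupport_subset j hj))
      exact (A.part j).contMDiff.contMDiffAt.comp h hone.contMDiffAt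
    -- Here the unit may lie outside the `j`-th chart and the Jacobian need not be smooth, but the
    -- partition factor vanishes nearby.
    · refine (contMDiffAt_const (c := (0 : ℝ))).congr_of_eventuallyEq ?_
      have hopen : IsOpen ((fun h => 𝒢.one (𝒢.src h)) ⁻¹' (tsupport (A.part j))ᶜ) :=
        (isClosed_tsupport _).isOpen_compl.preimage hone.continuous
      filter_upwards [hopen.mem_nhds hj] with k hk
      rw [image_eq_zero_of_notMem_tsupport hk, zero_mul]

open Classical in
/-- The contribution of the `i`-th chart to the integral over the target fibre of `x`, as a function
of the fibre coordinate. -/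
def integrand (i : G) (x : M) (f : G → ℝ) (y : Y) : ℝ :=
  if (x, y) ∈ (A.chart i).target then
    A.part i ((A.chart i).symm (x, y)) * A.weight (A.chart i) ((A.chart i).symm (x, y)) *
      f ((A.chart i).symm (x, y))
  else 0

theorem integrand_of_mem {i : G} {x : M} {y : Y} (h : (x, y) ∈ (A.chart i).target) (f : G → ℝ) :
    A.integrand i x f y = A.part i ((A.chart i).symm (x, y)) *
      A.weight (A.chart i) ((A.chart i).symm (x, y)) * f ((A.chart i).symm (x, y)) :=
  if_pos h

theorem integrand_of_notMem_image {i : G} {x : M} {y : Y}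
    (h : (x, y) ∉ A.chart i '' tsupport (A.part i)) (f : G → ℝ) : A.integrand i x f y = 0 := by
  rw [integrand]
  split_ifs with hxy
  · have : A.part i ((A.chart i).symm (x, y)) = 0 := by
      by_contra h0
      exact h ⟨_, subset_tsupport _ h0, (A.chart i).right_inv hxy⟩
    rw [this, zero_mul, zero_mul]
  · rfl

theorem mem_target_of_mem_image {i : G} {q : M × Y}
    (h : q ∈ A.chart i '' tsupport (A.part i)) : q ∈ (A.chart i).target := by
  obtain ⟨g, hg, rfl⟩ := h
  exact (A.chart i).map_source (A.tsupport_subset i hg)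

theorem isCompact_image (i : G) : IsCompact (A.chart i '' tsupport (A.part i)) :=
  (A.isCompact_tsupport i).image_of_continuousOn
    ((A.chart i).continuousOn.mono (A.tsupport_subset i))

theorem tgt_symm {i : G} {q : M × Y} (h : q ∈ (A.chart i).target) :
    𝒢.tgt ((A.chart i).symm q) = q.1 := (A.isTgtChart i).apply_symm h

theorem integrand_congr {i : G} {x : M} {f f' : G → ℝ} (h : ∀ g, 𝒢.tgt g = x → f g = f' g) :
    A.integrand i x f = A.integrand i x f' := by
  funext y
  by_cases hy : (x, y) ∈ (A.chart i).target
  · rw [A.integrand_of_mem hy, A.integrand_of_mem hy, h _ (A.tgt_symm hy)]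
  · rw [integrand, integrand, if_neg hy, if_neg hy]

theorem integrand_eq_zero {i : G} {x : M} {f : G → ℝ}
    (h : ∀ g, 𝒢.tgt g = x → f g ≠ 0 → A.part i g = 0) : A.integrand i x f = 0 := by
  funext y
  by_cases hy : (x, y) ∈ (A.chart i).target
  · rw [A.integrand_of_mem hy]
    by_cases hf : f ((A.chart i).symm (x, y)) = 0
    · simp [hf]
    · simp [h _ (A.tgt_symm hy) hf]
  · exact if_neg hy

theorem integrand_nonneg {i : G} {x : M} {f : G → ℝ} (h : ∀ g, 𝒢.tgt g = x → 0 ≤ f g) (y : Y) :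
    0 ≤ A.integrand i x f y := by
  rw [integrand]
  split_ifs with hy
  · exact mul_nonneg (mul_nonneg (A.part.nonneg _ _)
      (A.weight_pos (A.isTgtChart i) ((A.chart i).map_target hy)).le) (h _ (A.tgt_symm hy))
  · rfl

theorem hasCompactSupport_integrand (i : G) (x : M) (f : G → ℝ) :
    HasCompactSupport (A.integrand i x f) := by
  refine HasCompactSupport.intro ((A.isCompact_image i).image continuous_snd) fun y hy => ?_
  exact A.integrand_of_notMem_image (fun h => hy ⟨_, h, rfl⟩) f

section Continuity

variable [FiniteDimensional ℝ Y] [IsManifold 𝓘(ℝ, EG) ∞ G] [T2Space M]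

/-- Near a point of the compact image of the support the defining formula holds. The complement of
that image is open and the integrand is zero there, so extension by zero creates no jump. The points
`(x, z)` stay in one target fibre, hence continuity of `f` along it suffices. -/
theorem continuous_integrand {i : G} {x : M} {f : G → ℝ} (hf : ContinuousOn f {g | 𝒢.tgt g = x}) :
    Continuous (A.integrand i x f) := by
  refine continuous_iff_continuousAt.2 fun y => ?_
  by_cases hy : (x, y) ∈ A.chart i '' tsupport (A.part i)
  · have hy' := A.mem_target_of_mem_image hy
    have hopen : IsOpen {z : Y | (x, z) ∈ (A.chart i).target} :=
      (A.chart i).open_target.preimage (Continuous.prodMk_right x)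
    have hsymm : ContinuousAt (fun z : Y => (A.chart i).symm (x, z)) y :=
      ((A.chart i).continuousAt_symm hy').comp (f := fun z : Y => (x, z))
        (Continuous.prodMk_right x).continuousAt
    have hfc : ContinuousAt (fun z : Y => f ((A.chart i).symm (x, z))) y := by
      have h1 := (hf _ (A.tgt_symm hy')).comp (f := fun z : Y => (A.chart i).symm (x, z))
        (s := {z : Y | (x, z) ∈ (A.chart i).target}) hsymm.continuousWithinAt
        (fun z hz => A.tgt_symm hz)
      exact h1.continuousAt (hopen.mem_nhds hy')
    have hw : ContinuousAt (fun z : Y => A.weight (A.chart i) ((A.chart i).symm (x, z))) y :=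
      ContinuousAt.comp (g := A.weight (A.chart i))
        (A.contMDiffAt_weight (A.isTgtChart i) ((A.chart i).map_target hy')).continuousAt hsymm
    have hp : ContinuousAt (fun z : Y => A.part i ((A.chart i).symm (x, z))) y :=
      ContinuousAt.comp (g := A.part i) (A.part i).contMDiff.continuous.continuousAt hsymm
    refine ((hp.mul hw).mul hfc).congr ?_
    filter_upwards [hopen.mem_nhds hy'] with z hz
    exact (A.integrand_of_mem hz f).symm
  · have hopen : IsOpen ((fun z : Y => (x, z)) ⁻¹' (A.chart i '' tsupport (A.part i))ᶜ) :=
      (A.isCompact_image i).isClosed.isOpen_compl.preimage (Continuous.prodMk_right x)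
    refine (continuousAt_const (y := (0 : ℝ))).congr ?_
    filter_upwards [hopen.mem_nhds hy] with z hz
    exact (A.integrand_of_notMem_image hz f).symm

/-- The same dichotomy as for continuity, with parameters. The chart sends `(r p, y)` into the
target fibre over `r p`, so smoothness of `Φ` along the constraint `tgt g = r p` is enough to obtain
smoothness on an open set. -/
theorem contDiffOn_integrand {P : Type*} [NormedAddCommGroup P] [NormedSpace ℝ P]
    {O : Set P} (hO : IsOpen O) {r : P → M} (hr : ContMDiffOn 𝓘(ℝ, P) 𝓘(ℝ, EM) ∞ r O)
    {Φ : P → G → ℝ} (hΦ : ContMDiffOn (𝓘(ℝ, P).prod 𝓘(ℝ, EG)) 𝓘(ℝ, ℝ) ∞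
      (fun q : P × G => Φ q.1 q.2) {q | q.1 ∈ O ∧ 𝒢.tgt q.2 = r q.1}) (i : G) :
    ContDiffOn ℝ ∞ (fun q : P × Y => A.integrand i (r q.1) (Φ q.1) q.2) (O ×ˢ Set.univ) := by
  suffices h : ContMDiffOn (𝓘(ℝ, P).prod 𝓘(ℝ, Y)) 𝓘(ℝ, ℝ) ∞
      (fun q : P × Y => A.integrand i (r q.1) (Φ q.1) q.2) (O ×ˢ Set.univ) by
    rw [← modelWithCornersSelf_prod, chartedSpaceSelf_prod] at h
    exact h.contDiffOn
  have hOY : IsOpen (O ×ˢ (Set.univ : Set Y)) := hO.prod isOpen_univ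
  have hrY : ContMDiffOn (𝓘(ℝ, P).prod 𝓘(ℝ, Y)) (𝓘(ℝ, EM).prod 𝓘(ℝ, Y)) ∞
      (fun q : P × Y => (r q.1, q.2)) (O ×ˢ Set.univ) :=
    (hr.comp contMDiff_fst.contMDiffOn fun q hq => hq.1).prodMk contMDiff_snd.contMDiffOn
  rintro ⟨p, y⟩ hpy
  refine ContMDiffAt.contMDiffWithinAt ?_
  have hry : ContMDiffAt (𝓘(ℝ, P).prod 𝓘(ℝ, Y)) (𝓘(ℝ, EM).prod 𝓘(ℝ, Y)) ∞
      (fun q : P × Y => (r q.1, q.2)) (p, y) := hrY.contMDiffAt (hOY.mem_nhds hpy)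
  by_cases hy : (r p, y) ∈ A.chart i '' tsupport (A.part i)
  · have hy' := A.mem_target_of_mem_image hy
    have hD : IsOpen ((O ×ˢ Set.univ) ∩
        (fun q : P × Y => (r q.1, q.2)) ⁻¹' (A.chart i).target) :=
      hrY.continuousOn.isOpen_inter_preimage hOY (A.chart i).open_target
    have hDn := hD.mem_nhds (x := (p, y)) ⟨hpy, hy'⟩
    have hsymm : ContMDiffAt (𝓘(ℝ, P).prod 𝓘(ℝ, Y)) 𝓘(ℝ, EG) ∞
        (fun q : P × Y => (A.chart i).symm (r q.1, q.2)) (p, y) :=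
      ContMDiffAt.comp (p, y) (g := (A.chart i).symm)
        ((A.isTgtChart i).contMDiffAt_symm (q := (r p, y)) hy') hry
    have hfc : ContMDiffAt (𝓘(ℝ, P).prod 𝓘(ℝ, Y)) 𝓘(ℝ, ℝ) ∞
        (fun q : P × Y => Φ q.1 ((A.chart i).symm (r q.1, q.2))) (p, y) := by
      have h1 := (hΦ (p, (A.chart i).symm (r p, y)) ⟨hpy.1, A.tgt_symm hy'⟩).comp (p, y)
        (f := fun q : P × Y => (q.1, (A.chart i).symm (r q.1, q.2)))
        (s := (O ×ˢ Set.univ) ∩ (fun q : P × Y => (r q.1, q.2)) ⁻¹' (A.chart i).target)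
        (contMDiffAt_fst.prodMk hsymm).contMDiffWithinAt
        (fun q hq => ⟨hq.1.1, A.tgt_symm hq.2⟩)
      exact h1.contMDiffAt hDn
    have hw : ContMDiffAt (𝓘(ℝ, P).prod 𝓘(ℝ, Y)) 𝓘(ℝ, ℝ) ∞
        (fun q : P × Y => A.weight (A.chart i) ((A.chart i).symm (r q.1, q.2))) (p, y) :=
      ContMDiffAt.comp (p, y) (g := A.weight (A.chart i))
        (A.contMDiffAt_weight (A.isTgtChart i) ((A.chart i).map_target hy')) hsymm
    have hp : ContMDiffAt (𝓘(ℝ, P).prod 𝓘(ℝ, Y)) 𝓘(ℝ, ℝ) ∞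
        (fun q : P × Y => A.part i ((A.chart i).symm (r q.1, q.2))) (p, y) :=
      ContMDiffAt.comp (p, y) (g := A.part i) (A.part i).contMDiff.contMDiffAt hsymm
    refine ((hp.mul hw).mul hfc).congr_of_eventuallyEq ?_
    filter_upwards [hDn] with z hz
    exact A.integrand_of_mem hz.2 _
  · have hop : IsOpen (A.chart i '' tsupport (A.part i))ᶜ :=
      (A.isCompact_image i).isClosed.isOpen_compl
    refine (contMDiffAt_const (c := (0 : ℝ))).congr_of_eventuallyEq ?_
    filter_upwards [hry.continuousAt.preimage_mem_nhds (hop.mem_nhds hy)] with z hz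
    exact A.integrand_of_notMem_image hz _

end Continuity

end TgtAtlas

end LieGroupoid

/-! ### The fibre integral: finiteness, positivity, left invariance, smooth dependence -/

namespace LieGroupoid

namespace TgtAtlas

variable {EM EG Y : Type*}
  [NormedAddCommGroup EM] [NormedSpace ℝ EM]
  [NormedAddCommGroup EG] [NormedSpace ℝ EG]
  [NormedAddCommGroup Y] [NormedSpace ℝ Y]
  {M : Type*} [TopologicalSpace M] [ChartedSpace EM M]
  {G : Type*} [TopologicalSpace G] [ChartedSpace EG G]
  {𝒢 : LieGroupoid 𝓘(ℝ, EM) M 𝓘(ℝ, EG) G} (A : 𝒢.TgtAtlas Y)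

/-- The indices of the functions of the partition of unity that do not vanish on `K`. -/
def indices {K : Set G} (hK : IsCompact K) : Finset G :=
  (A.part.locallyFinite.finite_nonempty_inter_compact hK).toFinset

variable {A} in
theorem mem_indices {K : Set G} (hK : IsCompact K) {g i : G} (hg : g ∈ K)
    (hi : A.part i g ≠ 0) : i ∈ A.indices hK := by
  simp only [indices, Set.Finite.mem_toFinset, Set.mem_ofPred_eq]
  exact ⟨g, hi, hg⟩

theorem sum_indices_part {K : Set G} (hK : IsCompact K) {g : G} (hg : g ∈ K) :
    ∑ i ∈ A.indices hK, A.part i g = 1 := by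
  rw [← A.part.sum_eq_one (Set.mem_univ g)]
  exact (finsum_eq_sum_of_support_subset _ fun i hi => mem_indices hK hg hi).symm

variable [MeasurableSpace Y] (ν : Measure Y)

/-- The integral of `f` over the target fibre of `x` with respect to the left invariant density. -/
def integral (x : M) (f : G → ℝ) : ℝ := ∑ᶠ i, ∫ y, A.integrand i x f y ∂ν

/-- A compact set meets the supports of only finitely many functions of the partition. The index set
depends on `K` alone, so one finite sum serves all functions supported in `K` and all parameters at
once. -/
theorem integral_eq_sum {K : Set G} (hK : IsCompact K) {x : M} {f : G → ℝ}
    (hf : ∀ g, 𝒢.tgt g = x → f g ≠ 0 → g ∈ K) :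
    A.integral ν x f = ∑ i ∈ A.indices hK, ∫ y, A.integrand i x f y ∂ν := by
  refine finsum_eq_sum_of_support_subset _ fun i hi => ?_
  by_contra hiK
  refine hi ?_
  have : A.integrand i x f = 0 := A.integrand_eq_zero fun g hg hfg => by
    by_contra h0
    exact hiK (mem_indices hK (hf g hg hfg) h0)
  simp [this]

theorem integral_congr {x : M} {f f' : G → ℝ} (h : ∀ g, 𝒢.tgt g = x → f g = f' g) :
    A.integral ν x f = A.integral ν x f' := by
  simp only [integral, A.integrand_congr h]

variable [BorelSpace Y] [FiniteDimensional ℝ Y] [IsManifold 𝓘(ℝ, EG) ∞ G] [T2Space M] [ν.IsAddHaarMeasure]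

theorem integrable_integrand {i : G} {x : M} {f : G → ℝ}
    (hf : ContinuousOn f {g | 𝒢.tgt g = x}) : Integrable (A.integrand i x f) ν :=
  (A.continuous_integrand hf).integrable_of_hasCompactSupport (A.hasCompactSupport_integrand i x f)

theorem integral_sum {ι : Type*} (s : Finset ι) (a : ι → ℝ) {K : Set G} (hK : IsCompact K) {x : M}
    {f : ι → G → ℝ} (hf : ∀ j ∈ s, ContinuousOn (f j) {g | 𝒢.tgt g = x})
    (hfK : ∀ j ∈ s, ∀ g, 𝒢.tgt g = x → f j g ≠ 0 → g ∈ K) :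
    A.integral ν x (fun g => ∑ j ∈ s, a j * f j g) = ∑ j ∈ s, a j * A.integral ν x (f j) := by
  rw [A.integral_eq_sum ν hK]
  · have h : ∀ j ∈ s, a j * A.integral ν x (f j) =
        ∑ i ∈ A.indices hK, ∫ y, a j * A.integrand i x (f j) y ∂ν := fun j hj => by
      rw [A.integral_eq_sum ν hK (hfK j hj), Finset.mul_sum]
      simp only [integral_const_mul]
    rw [Finset.sum_congr rfl h, Finset.sum_comm]
    refine Finset.sum_congr rfl fun i _ => ?_
    rw [← integral_finsetSum s fun j hj => (A.integrable_integrand ν (hf j hj)).const_mul _]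
    congr 1
    funext y
    by_cases hy : (x, y) ∈ (A.chart i).target
    · simp only [A.integrand_of_mem hy, Finset.mul_sum]
      exact Finset.sum_congr rfl fun j _ => by ring
    · simp [integrand, hy]
  · intro g hg h0
    obtain ⟨j, hj, hj0⟩ := Finset.exists_ne_zero_of_sum_ne_zero h0
    exact hfK j hj g hg (right_ne_zero_of_mul hj0)

/-- Some partition function is positive at `g`, and the weight is positive in its chart; one summand
is thus the integral of a continuous nonnegative function that is not zero. -/
theorem integral_pos {x : M} {f : G → ℝ} (hf : ContinuousOn f {g | 𝒢.tgt g = x})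
    (hf0 : ∀ g, 𝒢.tgt g = x → 0 ≤ f g) {K : Set G} (hK : IsCompact K)
    (hfK : ∀ g, 𝒢.tgt g = x → f g ≠ 0 → g ∈ K) {g : G} (hg : 𝒢.tgt g = x) (hfg : f g ≠ 0) :
    0 < A.integral ν x f := by
  rw [A.integral_eq_sum ν hK hfK]
  obtain ⟨i, hi⟩ := A.part.exists_pos_of_mem (Set.mem_univ g)
  refine Finset.sum_pos' (fun j _ => integral_nonneg (A.integrand_nonneg hf0))
    ⟨i, mem_indices hK (hfK g hg hfg) hi.ne', ?_⟩
  refine (A.continuous_integrand hf).integral_pos_of_hasCompactSupport_nonneg_nonzero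
    (A.hasCompactSupport_integrand i x f) (A.integrand_nonneg hf0) (x := (A.chart i g).2) ?_
  have hgs := A.mem_source_of_part_ne_zero hi.ne'
  rw [← hg, A.integrand_of_mem ((A.isTgtChart i).mem_target hgs),
    (A.isTgtChart i).symm_mk_snd hgs]
  exact mul_ne_zero (mul_ne_zero hi.ne' (A.weight_pos (A.isTgtChart i) hgs).ne') hfg

/-- Change of variables along a left translation, for functions supported in two charts. -/
theorem integral_integrand_leftTrans (g i k : G) (f : G → ℝ) :
    ∫ y, A.integrand i (𝒢.src g) (fun h => A.part k (𝒢.mul g h) * f (𝒢.mul g h)) y ∂ν =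
      ∫ y, A.integrand k (𝒢.tgt g) (fun h => A.part i (𝒢.mul (𝒢.inv g) h) * f h) y ∂ν := by
  have hi := A.isTgtChart i
  have hk := A.isTgtChart k
  have hL : ∀ y, y ∉ 𝒢.leftTransDom (A.chart i) (A.chart k) g →
      A.integrand i (𝒢.src g) (fun h => A.part k (𝒢.mul g h) * f (𝒢.mul g h)) y = 0 := by
    intro y hy
    by_contra h0
    have hy1 : (𝒢.src g, y) ∈ (A.chart i).target := by
      by_contra h
      exact h0 (if_neg h)
    rw [A.integrand_of_mem hy1] at h0
    exact hy ⟨hy1, A.mem_source_of_part_ne_zero (left_ne_zero_of_mul (right_ne_zero_of_mul h0))⟩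
  have hR : ∀ y, y ∉ 𝒢.leftTransDom (A.chart k) (A.chart i) (𝒢.inv g) →
      A.integrand k (𝒢.tgt g) (fun h => A.part i (𝒢.mul (𝒢.inv g) h) * f h) y = 0 := by
    intro y hy
    by_contra h0
    have hy1 : (𝒢.tgt g, y) ∈ (A.chart k).target := by
      by_contra h
      exact h0 (if_neg h)
    rw [A.integrand_of_mem hy1] at h0
    refine hy ⟨by rwa [𝒢.src_inv], ?_⟩
    rw [𝒢.src_inv]
    exact A.mem_source_of_part_ne_zero (left_ne_zero_of_mul (right_ne_zero_of_mul h0))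
  -- Each integrand vanishes off the domain on which the translation, respectively its inverse, is
  -- defined in coordinates; the translation maps one domain bijectively onto the other.
  rw [← setIntegral_eq_integral_of_forall_compl_eq_zero hL,
    ← setIntegral_eq_integral_of_forall_compl_eq_zero hR,
    ← image_leftTrans hi hk, integral_image_eq_integral_abs_det_fderiv_smul ν
      (isOpen_leftTransDom hi g).measurableSet
      (fun y hy => (differentiableAt_leftTrans hi hk hy).hasFDerivAt.hasFDerivWithinAt)
      (injOn_leftTrans hi hk g)]
  -- The Jacobian of the substitution is exactly the ratio of the two weights.
  refine setIntegral_congr_fun (isOpen_leftTransDom hi g).measurableSet fun y hy => ?_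
  have hcomp := (hi.apply_symm hy.1).symm
  have hw := A.weight_mul hi hk hcomp ((A.chart i).map_target hy.1) hy.2
  rw [(A.chart i).right_inv hy.1] at hw
  simp only [A.integrand_of_mem hy.1, A.integrand_of_mem (mem_target_leftTrans hi hk hy),
    symm_leftTrans hi hk hy, 𝒢.inv_mul_cancel_left' hcomp, hw, smul_eq_mul]
  ring

/-- Left invariance of the fibre integral. -/
theorem integral_mul_left {g : G} {f : G → ℝ} (hf : ContinuousOn f {h | 𝒢.tgt h = 𝒢.tgt g})
    {K : Set G} (hK : IsCompact K) (hfK : ∀ h, 𝒢.tgt h = 𝒢.tgt g → f h ≠ 0 → h ∈ K) :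
    A.integral ν (𝒢.src g) (fun h => f (𝒢.mul g h)) = A.integral ν (𝒢.tgt g) f := by
  have hclosed : IsClosed {h | 𝒢.tgt h = 𝒢.tgt g} := isClosed_eq 𝒢.continuous_tgt continuous_const
  have hinv : ContinuousOn (𝒢.mul (𝒢.inv g)) {h | 𝒢.tgt h = 𝒢.tgt g} := by
    have := 𝒢.continuousOn_mul_left (𝒢.inv g)
    rwa [𝒢.src_inv] at this
  have hmaps : Set.MapsTo (𝒢.mul g) {h | 𝒢.tgt h = 𝒢.src g} {h | 𝒢.tgt h = 𝒢.tgt g} :=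
    fun h hh => 𝒢.tgt_mul _ _ (Eq.symm hh)
  -- The support of `f` over `tgt g`, translated back to the fibre over `src g`.
  let K' : Set G := 𝒢.mul (𝒢.inv g) '' (K ∩ {h | 𝒢.tgt h = 𝒢.tgt g})
  have hK' : IsCompact K' := (hK.inter_right hclosed).image_of_continuousOn
    (hinv.mono Set.inter_subset_right)
  have hfK' : ∀ h, 𝒢.tgt h = 𝒢.src g → f (𝒢.mul g h) ≠ 0 → h ∈ K' := fun h hh hfh =>
    ⟨𝒢.mul g h, ⟨hfK _ (hmaps hh) hfh, hmaps hh⟩, 𝒢.inv_mul_cancel_left' (Eq.symm hh)⟩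
  have hpart : ∀ i, Continuous (A.part i) := fun i => (A.part i).contMDiff.continuous
  -- Each side already carries the partition on its own fibre. Inserting the partition of the other
  -- fibre, transported by `g`, turns both into double sums over pairs of charts, which agree term
  -- by term. The factor `1` gives the sums the shape of `integral_sum`.
  have h1 : A.integral ν (𝒢.src g) (fun h => f (𝒢.mul g h)) = ∑ k ∈ A.indices hK,
      A.integral ν (𝒢.src g) (fun h => A.part k (𝒢.mul g h) * f (𝒢.mul g h)) := by
    rw [A.integral_congr ν (f' := fun h => ∑ k ∈ A.indices hK,
      1 * (A.part k (𝒢.mul g h) * f (𝒢.mul g h))), A.integral_sum ν _ _ hK']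
    · simp only [_root_.one_mul]
    · intro k _
      exact ((hpart k).comp_continuousOn (𝒢.continuousOn_mul_left g)).mul
        (hf.comp (𝒢.continuousOn_mul_left g) hmaps)
    · exact fun k _ h hh h0 => hfK' h hh (right_ne_zero_of_mul h0)
    · intro h hh
      simp only [_root_.one_mul, ← Finset.sum_mul]
      by_cases h0 : f (𝒢.mul g h) = 0
      · simp [h0]
      · rw [A.sum_indices_part hK (hfK _ (hmaps hh) h0), _root_.one_mul]
  have h2 : A.integral ν (𝒢.tgt g) f = ∑ i ∈ A.indices hK',
      A.integral ν (𝒢.tgt g) (fun h => A.part i (𝒢.mul (𝒢.inv g) h) * f h) := by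
    rw [A.integral_congr ν (f' := fun h => ∑ i ∈ A.indices hK',
      1 * (A.part i (𝒢.mul (𝒢.inv g) h) * f h)), A.integral_sum ν _ _ hK]
    · simp only [_root_.one_mul]
    · intro i _
      exact ((hpart i).comp_continuousOn hinv).mul hf
    · exact fun k _ h hh h0 => hfK h hh (right_ne_zero_of_mul h0)
    · intro h hh
      simp only [_root_.one_mul, ← Finset.sum_mul]
      by_cases h0 : f h = 0
      · simp [h0]
      · rw [A.sum_indices_part hK' ⟨h, ⟨hfK h hh h0, hh⟩, rfl⟩, _root_.one_mul]
  have h3 : ∀ k ∈ A.indices hK,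
      A.integral ν (𝒢.src g) (fun h => A.part k (𝒢.mul g h) * f (𝒢.mul g h)) =
      ∑ i ∈ A.indices hK', ∫ y, A.integrand k (𝒢.tgt g)
        (fun h => A.part i (𝒢.mul (𝒢.inv g) h) * f h) y ∂ν := fun k _ => by
    rw [A.integral_eq_sum ν hK' fun h hh h0 => hfK' h hh (right_ne_zero_of_mul h0)]
    exact Finset.sum_congr rfl fun i _ => A.integral_integrand_leftTrans ν g i k f
  have h4 : ∀ i ∈ A.indices hK',
      A.integral ν (𝒢.tgt g) (fun h => A.part i (𝒢.mul (𝒢.inv g) h) * f h) =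
      ∑ k ∈ A.indices hK, ∫ y, A.integrand k (𝒢.tgt g)
        (fun h => A.part i (𝒢.mul (𝒢.inv g) h) * f h) y ∂ν := fun i _ =>
    A.integral_eq_sum ν hK fun h hh h0 => hfK h hh (right_ne_zero_of_mul h0)
  rw [h1, h2, Finset.sum_congr rfl h3, Finset.sum_congr rfl h4, Finset.sum_comm]

/-- Fibre integrals depend smoothly on parameters. -/
theorem contDiffOn_integral {P : Type*} [NormedAddCommGroup P] [NormedSpace ℝ P]
    {O : Set P} (hO : IsOpen O) {r : P → M} (hr : ContMDiffOn 𝓘(ℝ, P) 𝓘(ℝ, EM) ∞ r O)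
    {Φ : P → G → ℝ} (hΦ : ContMDiffOn (𝓘(ℝ, P).prod 𝓘(ℝ, EG)) 𝓘(ℝ, ℝ) ∞
      (fun q : P × G => Φ q.1 q.2) {q | q.1 ∈ O ∧ 𝒢.tgt q.2 = r q.1})
    {K : Set G} (hK : IsCompact K)
    (hΦK : ∀ p ∈ O, ∀ g, 𝒢.tgt g = r p → Φ p g ≠ 0 → g ∈ K) :
    ContDiffOn ℝ ∞ (fun p => A.integral ν (r p) (Φ p)) O := by
  have h : ContDiffOn ℝ ∞ (fun p => ∑ i ∈ A.indices hK,
      ∫ y, A.integrand i (r p) (Φ p) y ∂ν) O := by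
    refine ContDiffOn.sum fun i _ => ?_
    exact contDiffOn_integral_of_compact ν hO ((A.isCompact_image i).image continuous_snd)
      (fun p y _ hy => A.integrand_of_notMem_image (fun h => hy ⟨_, h, rfl⟩) _)
      (A.contDiffOn_integrand hO hr hΦ i)
  exact h.congr fun p hp => A.integral_eq_sum ν hK (hΦK p hp)

end TgtAtlas

end LieGroupoid

/-! ### Cut-off functions and normalized averages -/

theorem Manifold.IsSubmersion.isOpenMap {E H E' H' : Type*}
    [NormedAddCommGroup E] [NormedSpace ℝ E] [TopologicalSpace H]
    [NormedAddCommGroup E'] [NormedSpace ℝ E'] [TopologicalSpace H']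
    {I : ModelWithCorners ℝ E H} {J : ModelWithCorners ℝ E' H'} [I.Boundaryless]
    {N : Type*} [TopologicalSpace N] [ChartedSpace H N]
    {N' : Type*} [TopologicalSpace N'] [ChartedSpace H' N'] {f : N → N'}
    (hf : Manifold.IsSubmersion I J ∞ f) : IsOpenMap f := by
  obtain ⟨Y, _, _, hY⟩ := hf
  refine isOpenMap_iff_nhds_le.2 fun n => ?_
  obtain ⟨e, he, hn⟩ := (hY n).exists_isFibreChart
  have h1 : Filter.map f (𝓝 n) = Filter.map (Prod.fst ∘ e) (𝓝 n) := by
    refine Filter.map_congr ?_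
    filter_upwards [e.open_source.mem_nhds hn] with m hm
    exact (he.fst_apply m hm).symm
  rw [h1, ← Filter.map_map, e.map_nhds_eq hn, map_fst_nhds, he.fst_apply n hn]

namespace LieGroupoid

variable {EM EG : Type*}
  [NormedAddCommGroup EM] [NormedSpace ℝ EM]
  [NormedAddCommGroup EG] [NormedSpace ℝ EG]
  {M : Type u} [TopologicalSpace M] [ChartedSpace EM M]
  {G : Type u} [TopologicalSpace G] [ChartedSpace EG G]

/-- A smooth nonnegative function on the objects whose pullback along the source map has compact
support, locally uniformly, on the target fibres, and vanishes on none of them. -/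
structure IsFibreCutoff (𝒢 : LieGroupoid 𝓘(ℝ, EM) M 𝓘(ℝ, EG) G) (c : M → ℝ) : Prop where
  contMDiff : ContMDiff 𝓘(ℝ, EM) 𝓘(ℝ, ℝ) ∞ c
  nonneg : ∀ x, 0 ≤ c x
  exists_isCompact : ∀ x, ∃ U ∈ 𝓝 x, ∃ K, IsCompact K ∧
    ∀ g, 𝒢.tgt g ∈ U → c (𝒢.src g) ≠ 0 → g ∈ K
  exists_ne_zero : ∀ x, ∃ g, 𝒢.tgt g = x ∧ c (𝒢.src g) ≠ 0

/-- Squaring makes the cut-off function nonnegative. Properness on the support gives compactness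
over compact sets, and integral one over a fibre forbids vanishing on it, because the measure does
not see the complement of the fibre. -/
theorem HaarSystem.IsCutoff.isFibreCutoff [FiniteDimensional ℝ EM]
    {𝒢 : LieGroupoid 𝓘(ℝ, EM) M 𝓘(ℝ, EG) G}
    [MeasurableSpace G] [BorelSpace G] {μ : 𝒢.HaarSystem} {c : M → ℝ} (hc : μ.IsCutoff c) :
    𝒢.IsFibreCutoff (fun x => c x * c x) where
  contMDiff := hc.contMDiff.mul hc.contMDiff
  nonneg x := mul_self_nonneg _
  exists_isCompact x := by
    have : LocallyCompactSpace M := Manifold.locallyCompact_of_finiteDimensional 𝓘(ℝ, EM)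
    obtain ⟨U, hU, hxU⟩ := exists_compact_mem_nhds x
    refine ⟨U, hxU, _, (hc.isProperMap.isCompact_preimage hU).image continuous_subtype_val, ?_⟩
    intro g hg h0
    exact ⟨⟨g, subset_tsupport _ (left_ne_zero_of_mul h0)⟩, hg, rfl⟩
  exists_ne_zero x := by
    by_contra! h
    have h0 : ∫ g, c (𝒢.src g) ∂(μ.measure x) = 0 := by
      refine integral_eq_zero_of_ae ?_
      have : ∀ᵐ g ∂(μ.measure x), 𝒢.tgt g = x := μ.measure_compl_fibre x
      filter_upwards [this] with g hg
      exact mul_self_eq_zero.1 (h g hg)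
    rw [hc.integral_eq_one x] at h0
    exact one_ne_zero h0

/-- The union of the orbits that meet `S`. -/
def saturation (𝒢 : LieGroupoid 𝓘(ℝ, EM) M 𝓘(ℝ, EG) G) (S : Set M) : Set M :=
  𝒢.tgt '' (𝒢.src ⁻¹' S)

section Saturation

variable {𝒢 : LieGroupoid 𝓘(ℝ, EM) M 𝓘(ℝ, EG) G}

theorem saturation_mono {S T : Set M} (h : S ⊆ T) : 𝒢.saturation S ⊆ 𝒢.saturation T :=
  Set.image_mono (Set.preimage_mono h)

theorem subset_saturation (S : Set M) : S ⊆ 𝒢.saturation S :=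
  fun x hx => ⟨𝒢.one x, by rwa [Set.mem_preimage, 𝒢.src_one], 𝒢.tgt_one x⟩

theorem tgt_mem_saturation {S : Set M} {g : G} (h : 𝒢.src g ∈ 𝒢.saturation S) :
    𝒢.tgt g ∈ 𝒢.saturation S := by
  obtain ⟨k, hk, hkg⟩ := h
  exact ⟨𝒢.mul g k, by rwa [Set.mem_preimage, 𝒢.src_mul _ _ hkg.symm], 𝒢.tgt_mul _ _ hkg.symm⟩

theorem src_mem_saturation {S : Set M} {g : G} (h : 𝒢.tgt g ∈ S) : 𝒢.src g ∈ 𝒢.saturation S :=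
  ⟨𝒢.inv g, by rwa [Set.mem_preimage, 𝒢.src_inv], 𝒢.tgt_inv g⟩

theorem isOpen_saturation {S : Set M} (hS : IsOpen S) : IsOpen (𝒢.saturation S) :=
  𝒢.isSubmersion_tgt.isOpenMap _ (hS.preimage 𝒢.continuous_src)

/-- A proper map is closed, so the range of `(src, tgt)` is closed; the saturation is the projection
of its part over the compact factor `S`. -/
theorem IsProper.isClosed_saturation (h𝒢 : 𝒢.IsProper) {S : Set M} (hS : IsCompact S) :
    IsClosed (𝒢.saturation S) := by
  have : CompactSpace S := isCompact_iff_compactSpace.1 hS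
  have h1 : IsClosed (Set.range fun g : G => (𝒢.src g, 𝒢.tgt g)) :=
    IsProperMap.isClosedMap h𝒢 |>.isClosed_range
  have h2 : IsClosed ((fun q : S × M => (q.1.1, q.2)) ⁻¹'
      (Set.range fun g : G => (𝒢.src g, 𝒢.tgt g))) := h1.preimage (by fun_prop)
  have h3 := isClosedMap_snd_of_compactSpace _ h2
  convert h3 using 1
  ext x
  constructor
  · rintro ⟨g, hg, rfl⟩
    exact ⟨(⟨𝒢.src g, hg⟩, 𝒢.tgt g), ⟨g, rfl⟩, rfl⟩
  · rintro ⟨⟨⟨y, hy⟩, z⟩, ⟨g, hg⟩, rfl⟩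
    simp only [Prod.mk.injEq] at hg
    exact ⟨g, by rw [Set.mem_preimage, hg.1]; exact hy, hg.2⟩

/-- The `n`-th bump function lives in `K (n + 2)` and vanishes on all orbits that meet `K (n - 1)`.
An orbit through `K m` therefore sees only the bumps with `n ≤ m`, and properness makes the arrows
from `K (m + 2)` to `K m` compact. Every orbit meets a bump at the stage where it first meets the
exhaustion. -/
theorem IsProper.exists_isFibreCutoff [FiniteDimensional ℝ EM] [T2Space M] [SigmaCompactSpace M]
    [IsManifold 𝓘(ℝ, EM) ∞ M] (h𝒢 : 𝒢.IsProper) : ∃ c, 𝒢.IsFibreCutoff c := by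
  have : LocallyCompactSpace M := Manifold.locallyCompact_of_finiteDimensional 𝓘(ℝ, EM)
  -- The shift gives `K 0 = ∅`, which settles the truncated subtraction `n - 1` at `n = 0` and makes
  -- the first stage met by an orbit a successor.
  let K : CompactExhaustion M := (CompactExhaustion.choice M).shiftr
  have hK0 : K 0 = ∅ := rfl
  have hKpred : ∀ n, K (n - 1) ⊆ interior (K n) := by
    rintro (_ | n)
    · simp [hK0]
    · exact K.subset_interior_succ n
  have hex : ∀ n, ∃ f : C^∞⟮𝓘(ℝ, EM), M; 𝓘(ℝ, ℝ), ℝ⟯,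
      Set.EqOn f 0 ((interior (K (n + 2)))ᶜ ∪ 𝒢.saturation (K (n - 1))) ∧
      Set.EqOn f 1 (K (n + 1) \ 𝒢.saturation (interior (K n))) ∧ ∀ x, f x ∈ Set.Icc 0 1 := by
    intro n
    refine exists_contMDiffMap_zero_one_of_isClosed 𝓘(ℝ, EM) (n := ⊤) ?_ ?_ ?_
    · exact isOpen_interior.isClosed_compl.union (h𝒢.isClosed_saturation (K.isCompact _))
    · exact ((K.isCompact _).diff (isOpen_saturation isOpen_interior)).isClosed
    · refine Set.disjoint_left.2 ?_
      rintro x (hx | hx) ⟨hx1, hx2⟩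
      · exact hx (K.subset_interior_succ _ hx1)
      · exact hx2 (saturation_mono (hKpred n) hx)
  choose f hf0 hf1 hf01 using hex
  have hsat : ∀ m n x, x ∈ 𝒢.saturation (K m) → f n x ≠ 0 → n ≤ m := by
    intro m n x hx hn
    by_contra! hmn
    exact hn (hf0 n (Or.inr (saturation_mono (K.subset (by omega)) hx)))
  have hlf : LocallyFinite fun n => Function.support (f n) := by
    intro x
    obtain ⟨m, hm⟩ := K.exists_mem_nhds x
    refine ⟨K m, hm, (Set.finite_Iic m).subset ?_⟩
    rintro n ⟨y, hy, hyK⟩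
    exact hsat m n y (subset_saturation _ hyK) hy
  have hfin : ∀ x, (Function.support fun n => f n x).Finite := fun x => hlf.point_finite x
  refine ⟨fun x => ∑ᶠ n, f n x, contMDiff_finsum (fun n => (f n).contMDiff) hlf,
    fun x => finsum_nonneg fun n => (hf01 n x).1, fun x => ?_, fun x => ?_⟩
  · obtain ⟨m, hm⟩ := K.exists_mem_nhds x
    refine ⟨K m, hm, _, IsProperMap.isCompact_preimage h𝒢
      ((K.isCompact (m + 2)).prod (K.isCompact m)), fun g hg h0 => ?_⟩
    obtain ⟨n, hn⟩ : ∃ n, f n (𝒢.src g) ≠ 0 := by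
      by_contra! h
      exact h0 (by simp [h])
    have hnm := hsat m n _ (src_mem_saturation hg) hn
    refine ⟨?_, hg⟩
    by_contra hns
    refine hn (hf0 n (Or.inl fun h => hns ?_))
    exact K.subset (by omega) (interior_subset h)
  · have hx : ∃ m, x ∈ 𝒢.saturation (K m) :=
      (K.exists_mem x).imp fun m hm => subset_saturation _ hm
    classical
    have hmin := fun m => Nat.find_min hx (m := m)
    have hspec := Nat.find_spec hx
    -- The orbit of `x` meets `K (n + 1)` but not `K n`, so the `n`-th bump equals `1` at its points
    -- in `K (n + 1)`.
    obtain ⟨n, hn⟩ : ∃ n, Nat.find hx = n + 1 := by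
      refine Nat.exists_eq_succ_of_ne_zero fun h => ?_
      rw [h, hK0] at hspec
      simp [saturation] at hspec
    rw [hn] at hspec hmin
    obtain ⟨g, hg, rfl⟩ := hspec
    refine ⟨g, rfl, ?_⟩
    have h1 : f n (𝒢.src g) = 1 := hf1 n ⟨hg, fun h => hmin n (Nat.lt_succ_self n)
      (tgt_mem_saturation (saturation_mono interior_subset h))⟩
    have h2 := single_le_finsum n (hfin (𝒢.src g)) fun j => (hf01 j (𝒢.src g)).1
    rw [h1] at h2
    exact (zero_lt_one.trans_le h2).ne'

end Saturation

/-- A normalized, left invariant way of averaging functions over the target fibres which preserves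
smoothness. -/
structure IsAverage (𝒢 : LieGroupoid 𝓘(ℝ, EM) M 𝓘(ℝ, EG) G) (a : M → (G → ℝ) → ℝ) : Prop where
  congr : ∀ {x : M} {f f' : G → ℝ}, (∀ g, 𝒢.tgt g = x → f g = f' g) → a x f = a x f'
  const : ∀ (x : M) (r : ℝ), a x (fun _ => r) = r
  sum : ∀ {ι : Type} (s : Finset ι) (b : ι → ℝ) {x : M} {f : ι → G → ℝ},
    (∀ j ∈ s, ContinuousOn (f j) {g | 𝒢.tgt g = x}) →
    a x (fun g => ∑ j ∈ s, b j * f j g) = ∑ j ∈ s, b j * a x (f j)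
  mul_left : ∀ {g : G} {f : G → ℝ}, ContinuousOn f {h | 𝒢.tgt h = 𝒢.tgt g} →
    a (𝒢.src g) (fun h => f (𝒢.mul g h)) = a (𝒢.tgt g) f
  contDiffOn : ∀ {P : Type w} [NormedAddCommGroup P] [NormedSpace ℝ P] {O : Set P}, IsOpen O →
    ∀ {r : P → M}, ContMDiffOn 𝓘(ℝ, P) 𝓘(ℝ, EM) ∞ r O →
    ∀ {Φ : P → G → ℝ}, ContMDiffOn (𝓘(ℝ, P).prod 𝓘(ℝ, EG)) 𝓘(ℝ, ℝ) ∞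
      (fun q : P × G => Φ q.1 q.2) {q | q.1 ∈ O ∧ 𝒢.tgt q.2 = r q.1} →
    ContDiffOn ℝ ∞ (fun p => a (r p) (Φ p)) O

/-- The average is the mean with density `c ∘ src`. Left translation preserves sources and hence
this density, so numerator and denominator are both left invariant; the denominator is positive, so
the quotient is defined and smooth. -/
theorem IsFibreCutoff.exists_isAverage [FiniteDimensional ℝ EG] [T2Space M] [T2Space G]
    [SigmaCompactSpace G] [IsManifold 𝓘(ℝ, EG) ∞ G]
    {𝒢 : LieGroupoid 𝓘(ℝ, EM) M 𝓘(ℝ, EG) G} {c : M → ℝ} (hc : 𝒢.IsFibreCutoff c) :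
    ∃ a, IsAverage.{u, w} 𝒢 a := by
  obtain ⟨Y, _, _, hY⟩ := 𝒢.isSubmersion_tgt
  obtain ⟨A⟩ := exists_tgtAtlas hY
  -- An arrow is needed to see that the fibre model `Y` is finite-dimensional; without arrows there
  -- are no objects either.
  rcases isEmpty_or_nonempty G with hG | ⟨⟨g₀⟩⟩
  · have hM : IsEmpty M := ⟨fun x => hG.false (𝒢.one x)⟩
    refine ⟨fun _ _ => 0, ⟨?_, ?_, ?_, ?_, ?_⟩⟩
    · exact fun {x} => (hM.false x).elim
    · exact fun x => (hM.false x).elim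
    · exact fun _ _ x => (hM.false x).elim
    · exact fun {g} => (hG.false g).elim
    · intros
      exact contDiffOn_const
  have hYfin : FiniteDimensional ℝ Y := by
    let q := (hY g₀).equiv
    refine Module.Finite.of_surjective (LinearMap.snd ℝ EM Y ∘ₗ q.toLinearEquiv.toLinearMap) ?_
    exact Prod.snd_surjective.comp q.surjective
  borelize Y
  let ν : Measure Y := Measure.addHaar
  have hcs : Continuous fun g : G => c (𝒢.src g) := hc.contMDiff.continuous.comp 𝒢.continuous_src
  have hcpt : ∀ x, ∃ K, IsCompact K ∧ ∀ g, 𝒢.tgt g = x → c (𝒢.src g) ≠ 0 → g ∈ K := fun x => by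
    obtain ⟨U, hU, K, hK, h⟩ := hc.exists_isCompact x
    exact ⟨K, hK, fun g hg => h g (hg ▸ mem_of_mem_nhds hU)⟩
  have hpos : ∀ x, 0 < A.integral ν x (fun g => c (𝒢.src g)) := fun x => by
    obtain ⟨K, hK, hcK⟩ := hcpt x
    obtain ⟨g, hg, hg0⟩ := hc.exists_ne_zero x
    exact A.integral_pos ν hcs.continuousOn (fun g _ => hc.nonneg _) hK hcK hg hg0
  have hinv : ∀ {g : G} {f : G → ℝ}, ContinuousOn f {h | 𝒢.tgt h = 𝒢.tgt g} →
      A.integral ν (𝒢.src g) (fun h => c (𝒢.src h) * f (𝒢.mul g h)) =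
        A.integral ν (𝒢.tgt g) (fun h => c (𝒢.src h) * f h) := fun {g f} hf => by
    obtain ⟨K, hK, hcK⟩ := hcpt (𝒢.tgt g)
    rw [← A.integral_mul_left ν (f := fun h => c (𝒢.src h) * f h) (hcs.continuousOn.mul hf) hK
      fun h hh h0 => hcK h hh (left_ne_zero_of_mul h0)]
    exact A.integral_congr ν fun h hh => by rw [𝒢.src_mul _ _ hh.symm]
  refine ⟨fun x f => A.integral ν x (fun g => c (𝒢.src g) * f g) /
    A.integral ν x (fun g => c (𝒢.src g)), ⟨?_, ?_, ?_, ?_, ?_⟩⟩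
  · intro x f f' h
    simp only [A.integral_congr ν (f := fun g => c (𝒢.src g) * f g) fun g hg => by rw [h g hg]]
  · intro x r
    obtain ⟨K, hK, hcK⟩ := hcpt x
    -- Scalars are pulled out by linearity over a one-element index set.
    have h := A.integral_sum ν (Finset.univ : Finset Unit) (fun _ => r) hK
      (f := fun _ g => c (𝒢.src g)) (fun _ _ => hcs.continuousOn) (fun _ _ => hcK)
    simp only [Finset.univ_unique, Finset.sum_singleton] at h
    simp only [mul_comm _ r, h]
    exact mul_div_cancel_right₀ r (hpos x).ne'
  · intro ι s b x f hf
    obtain ⟨K, hK, hcK⟩ := hcpt x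
    have h := A.integral_sum ν s b hK (f := fun j g => c (𝒢.src g) * f j g)
      (fun j hj => hcs.continuousOn.mul (hf j hj))
      (fun j _ g hg h0 => hcK g hg (left_ne_zero_of_mul h0))
    simp only [← mul_div_assoc, ← Finset.sum_div, ← h]
    congr 2
    funext g
    rw [Finset.mul_sum]
    exact Finset.sum_congr rfl fun j _ => by ring
  · intro g f hf
    have h1 := hinv (g := g) (f := fun _ => 1) continuousOn_const
    simp only [_root_.mul_one] at h1
    simp only [hinv hf, h1]
  · intro P _ _ O hO r hr Φ hΦ p hp
    refine ContDiffAt.contDiffWithinAt ?_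
    -- A common compact support exists only locally in the base, so smoothness is checked near each
    -- parameter.
    obtain ⟨U, hU, K, hK, hcK⟩ := hc.exists_isCompact (r p)
    have hO' : IsOpen (O ∩ r ⁻¹' interior U) :=
      hr.continuousOn.isOpen_inter_preimage hO isOpen_interior
    have hpO' : O ∩ r ⁻¹' interior U ∈ 𝓝 p :=
      hO'.mem_nhds ⟨hp, mem_interior_iff_mem_nhds.2 hU⟩
    have hcq : ContMDiff (𝓘(ℝ, P).prod 𝓘(ℝ, EG)) 𝓘(ℝ, ℝ) ∞
        (fun q : P × G => c (𝒢.src q.2)) :=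
      hc.contMDiff.comp (𝒢.isSubmersion_src.contMDiff.comp contMDiff_snd)
    have hmem : ∀ q ∈ O ∩ r ⁻¹' interior U, ∀ g, 𝒢.tgt g = r q → c (𝒢.src g) ≠ 0 → g ∈ K :=
      fun q hq g hg => hcK g (hg ▸ interior_subset hq.2)
    have h1 := A.contDiffOn_integral ν hO' (hr.mono Set.inter_subset_left)
      (Φ := fun p g => c (𝒢.src g) * Φ p g)
      (hcq.contMDiffOn.mul (hΦ.mono fun q hq => ⟨hq.1.1, hq.2⟩)) hK
      (fun q hq g hg h0 => hmem q hq g hg (left_ne_zero_of_mul h0))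
    have h2 := A.contDiffOn_integral ν hO' (hr.mono Set.inter_subset_left)
      (Φ := fun p g => c (𝒢.src g)) hcq.contMDiffOn hK hmem
    exact (h1.contDiffAt hpO').div (h2.contDiffAt hpO') (hpos _).ne'

end LieGroupoid

/-! ### Homogeneous maps of vector bundles and local lifts -/

section BundleMaps

variable {EM EG : Type*}
  [NormedAddCommGroup EM] [NormedSpace ℝ EM] [NormedAddCommGroup EG] [NormedSpace ℝ EG]
  {M : Type*} [TopologicalSpace M] [ChartedSpace EM M]
  {G : Type*} [TopologicalSpace G] [ChartedSpace EG G]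
  {FE : Type*} [NormedAddCommGroup FE] [NormedSpace ℝ FE]
  {EE : M → Type*} [∀ x, AddCommGroup (EE x)] [∀ x, Module ℝ (EE x)]
  [∀ x, TopologicalSpace (EE x)] [TopologicalSpace (TotalSpace FE EE)] [FiberBundle FE EE]
  [VectorBundle ℝ FE EE]
  {FV : Type*} [NormedAddCommGroup FV] [NormedSpace ℝ FV]
  {VV : G → Type*} [∀ g, AddCommGroup (VV g)] [∀ g, Module ℝ (VV g)]
  [∀ g, TopologicalSpace (VV g)] [TopologicalSpace (TotalSpace FV VV)] [FiberBundle FV VV]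
  [VectorBundle ℝ FV VV]

/-- Smoothness of a map into a single fibre of a vector bundle. -/
theorem contMDiff_totalSpace_mk (g : G) {X : Type*} [NormedAddCommGroup X] [NormedSpace ℝ X]
    {v : X → VV g}
    (hv : ContDiff ℝ ∞ fun x => VectorBundle.continuousLinearEquivAt ℝ FV VV g (v x)) :
    ContMDiff 𝓘(ℝ, X) (𝓘(ℝ, EG).prod 𝓘(ℝ, FV)) ∞ (fun x => (⟨g, v x⟩ : TotalSpace FV VV)) :=
  fun _ => (contMDiffAt_totalSpace ..).2 ⟨contMDiffAt_const, hv.contMDiff.contMDiffAt⟩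

variable {f : TotalSpace FV VV → TotalSpace FE EE} {f₀ : G → M}

/-- A smooth map of vector bundles that commutes with the multiplication by nonnegative scalars is
fibrewise linear. -/
theorem exists_linearMap_of_homogeneous
    (hf : ContMDiff (𝓘(ℝ, EG).prod 𝓘(ℝ, FV)) (𝓘(ℝ, EM).prod 𝓘(ℝ, FE)) ∞ f)
    (hproj : ∀ ξ, (f ξ).proj = f₀ ξ.proj)
    (hom : ∀ r : ℝ, 0 ≤ r → ∀ ξ, f (fibreScale FV r ξ) = fibreScale FE r (f ξ)) (g : G) :
    ∃ L : VV g →ₗ[ℝ] EE (f₀ g), ∀ v, f ⟨g, v⟩ = ⟨f₀ g, L v⟩ := by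
  have hex : ∀ v : VV g, ∃ z : EE (f₀ g), f ⟨g, v⟩ = ⟨f₀ g, z⟩ := by
    intro v
    have h := hproj ⟨g, v⟩
    generalize f ⟨g, v⟩ = ζ at h
    obtain ⟨x, z⟩ := ζ
    obtain rfl : x = f₀ g := h
    exact ⟨z, rfl⟩
  choose F hF using hex
  have hFhom : ∀ r : ℝ, 0 ≤ r → ∀ v, F (r • v) = r • F v := by
    intro r hr v
    have h := hom r hr ⟨g, v⟩
    rw [hF v, show fibreScale FV r (⟨g, v⟩ : TotalSpace FV VV) = ⟨g, r • v⟩ from rfl, hF (r • v)]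
      at h
    exact TotalSpace.mk_inj.1 h
  let a := VectorBundle.continuousLinearEquivAt ℝ FV VV g
  let b := VectorBundle.continuousLinearEquivAt ℝ FE EE (f₀ g)
  -- Reading the fibre map in linear coordinates reduces the claim to homogeneous functions on
  -- normed spaces.
  let U : FV → FE := fun y => b (F (a.symm y))
  have hU : ContDiff ℝ ∞ U := by
    have h1 : ContMDiff 𝓘(ℝ, FV) (𝓘(ℝ, EG).prod 𝓘(ℝ, FV)) ∞
        (fun y => (⟨g, a.symm y⟩ : TotalSpace FV VV)) :=
      contMDiff_totalSpace_mk g (by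
        simp only [a, ContinuousLinearEquiv.apply_symm_apply]
        exact contDiff_id)
    refine ContMDiff.contDiff fun y => ?_
    have h2 := ((contMDiffAt_totalSpace ..).1 ((hf.comp h1) y)).2
    simp only [Function.comp_apply, hF] at h2
    exact h2
  have hUhom : ∀ r : ℝ, 0 ≤ r → ∀ y, U (r • y) = r • U y := by
    intro r hr y
    simp only [U, map_smul, hFhom r hr]
  have hUlin := eq_fderiv_of_homogeneous (hU.differentiable (by simp) 0) hUhom
  refine ⟨b.symm.toLinearMap ∘ₗ (fderiv ℝ U 0).toLinearMap ∘ₗ a.toLinearMap, fun v => ?_⟩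
  rw [hF v]
  congr 1
  change F v = b.symm (fderiv ℝ U 0 (a v))
  rw [← hUlin]
  simp [U]

/-- Locally, a fibrewise linear submersion of vector bundles has smooth right inverses along the
fibres. -/
theorem exists_local_lift [FiniteDimensional ℝ FE] [FiniteDimensional ℝ FV]
    [IsManifold 𝓘(ℝ, EM) ∞ M] [IsManifold 𝓘(ℝ, EG) ∞ G]
    [ContMDiffVectorBundle ∞ FE EE 𝓘(ℝ, EM)] [ContMDiffVectorBundle ∞ FV VV 𝓘(ℝ, EG)]
    (hf : Manifold.IsSubmersion (𝓘(ℝ, EG).prod 𝓘(ℝ, FV)) (𝓘(ℝ, EM).prod 𝓘(ℝ, FE)) ∞ f)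
    (hf₀ : ContMDiff 𝓘(ℝ, EG) 𝓘(ℝ, EM) ∞ f₀)
    (hproj : ∀ ξ, (f ξ).proj = f₀ ξ.proj)
    (hom : ∀ r : ℝ, 0 ≤ r → ∀ ξ, f (fibreScale FV r ξ) = fibreScale FE r (f ξ)) (h₀ : G) :
    ∃ σ : TotalSpace FE EE → G → TotalSpace FV VV, ∃ U : Set G, IsOpen U ∧ h₀ ∈ U ∧
      (∀ h ∈ U, ∀ e : TotalSpace FE EE, e.proj = f₀ h → (σ e h).proj = h ∧ f (σ e h) = e) ∧
      ∀ h ∈ U, ∀ e : TotalSpace FE EE, e.proj = f₀ h →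
        ContMDiffAt ((𝓘(ℝ, EM).prod 𝓘(ℝ, FE)).prod 𝓘(ℝ, EG)) (𝓘(ℝ, EG).prod 𝓘(ℝ, FV)) ∞
          (fun q : TotalSpace FE EE × G => σ q.1 q.2) (e, h) := by
  set tV := trivializationAt FV VV h₀ with htV
  set tE := trivializationAt FE EE (f₀ h₀) with htE
  have hmV : h₀ ∈ tV.baseSet := FiberBundle.mem_baseSet_trivializationAt' h₀
  have hmE : f₀ h₀ ∈ tE.baseSet := FiberBundle.mem_baseSet_trivializationAt' _
  let W : Set G := tV.baseSet ∩ f₀ ⁻¹' tE.baseSet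
  have hW : IsOpen W := tV.open_baseSet.inter (tE.open_baseSet.preimage hf₀.continuous)
  have hsV : ContMDiffOn (𝓘(ℝ, EG).prod 𝓘(ℝ, FV)) (𝓘(ℝ, EG).prod 𝓘(ℝ, FV)) ∞
      tV.toOpenPartialHomeomorph.symm tV.target := tV.contMDiffOn_symm
  have hfV : ContMDiffOn (𝓘(ℝ, EG).prod 𝓘(ℝ, FV)) (𝓘(ℝ, EG).prod 𝓘(ℝ, FV)) ∞
      tV tV.source := tV.contMDiffOn
  have hfE : ContMDiffOn (𝓘(ℝ, EM).prod 𝓘(ℝ, FE)) (𝓘(ℝ, EM).prod 𝓘(ℝ, FE)) ∞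
      tE tE.source := tE.contMDiffOn
  have hsymm : ∀ {h : G} {v : FV}, h ∈ tV.baseSet →
      (tV.toOpenPartialHomeomorph.symm (h, v)).proj = h := fun {h v} hh =>
    tV.proj_symm_apply' hh
  let T : G → FV → FE := fun h v => (tE (f (tV.toOpenPartialHomeomorph.symm (h, v)))).2
  have hTsm : ∀ h ∈ W, ∀ v, ContMDiffAt (𝓘(ℝ, EG).prod 𝓘(ℝ, FV)) 𝓘(ℝ, FE) ∞
      (fun q : G × FV => T q.1 q.2) (h, v) := by
    intro h hh v
    have h1 : ContMDiffAt (𝓘(ℝ, EG).prod 𝓘(ℝ, FV)) (𝓘(ℝ, EG).prod 𝓘(ℝ, FV)) ∞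
        tV.toOpenPartialHomeomorph.symm (h, v) :=
      hsV.contMDiffAt (tV.open_target.mem_nhds (tV.mem_target.2 hh.1))
    have h2 : ContMDiffAt (𝓘(ℝ, EM).prod 𝓘(ℝ, FE)) (𝓘(ℝ, EM).prod 𝓘(ℝ, FE)) ∞ tE
        (f (tV.toOpenPartialHomeomorph.symm (h, v))) :=
      hfE.contMDiffAt (tE.open_source.mem_nhds (tE.mem_source.2 (by
        rw [hproj, hsymm hh.1]; exact hh.2)))
    exact contMDiffAt_snd.comp _ (h2.comp (h, v) ((hf.contMDiff _).comp (h, v) h1))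
  have hThom : ∀ h ∈ W, ∀ r : ℝ, 0 ≤ r → ∀ v, T h (r • v) = r • T h v := by
    intro h hh r hr v
    obtain ⟨L, hL⟩ := exists_linearMap_of_homogeneous hf.contMDiff hproj hom h
    simp only [T, tV.symm_apply_eq_mk_continuousLinearEquivAt_symm (R := ℝ) h hh.1, hL,
      tE.apply_eq_prod_continuousLinearEquivAt ℝ _ hh.2, map_smul]
  let A : G → FV →L[ℝ] FE := fun h => fderiv ℝ (T h) 0
  have hTA : ∀ h ∈ W, ∀ v, T h v = A h v := by
    intro h hh v
    refine eq_fderiv_of_homogeneous ?_ (hThom h hh) v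
    have : ContMDiffAt 𝓘(ℝ, FV) 𝓘(ℝ, FE) ∞ (T h) 0 :=
      (hTsm h hh 0).comp (0 : FV) (f := fun v => (h, v)) (contMDiffAt_const.prodMk contMDiffAt_id)
    exact this.contDiffAt.differentiableAt (by simp)
  have hA : ∀ h ∈ W, ContMDiffAt 𝓘(ℝ, EG) 𝓘(ℝ, FV →L[ℝ] FE) ∞ A h := fun h hh =>
    (hTsm h hh 0).fderiv_param (y := fun _ => (0 : FV)) contMDiffAt_const
  -- The submersion hypothesis concerns total spaces. To get surjectivity on the fibre, the curve `ε
  -- ↦ ε y` in the fibre of `E` is lifted to a curve through the zero vector at `h₀` and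
  -- differentiated at `0`; the base point of the lift may move.
  have hsurj : Function.Surjective (A h₀) := by
    intro y
    obtain ⟨Y, _, _, hY⟩ := id hf
    obtain ⟨L, hL⟩ := exists_linearMap_of_homogeneous hf.contMDiff hproj hom h₀
    let ζ : TotalSpace FV VV := ⟨h₀, 0⟩
    obtain ⟨c, hc, hζ⟩ := (hY ζ).exists_isFibreChart
    let b := VectorBundle.continuousLinearEquivAt ℝ FE EE (f₀ h₀)
    let κ : ℝ → TotalSpace FE EE := fun ε => ⟨f₀ h₀, b.symm (ε • y)⟩
    have hκ : ContMDiff 𝓘(ℝ, ℝ) (𝓘(ℝ, EM).prod 𝓘(ℝ, FE)) ∞ κ :=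
      contMDiff_totalSpace_mk (f₀ h₀) (by
        simp only [b, ContinuousLinearEquiv.apply_symm_apply]
        exact contDiff_id.smul contDiff_const)
    have hκ0 : κ 0 = f ζ := by simp [κ, ζ, hL]
    let γ : ℝ → TotalSpace FV VV := fun ε => c.symm (κ ε, (c ζ).2)
    have hmem : (κ 0, (c ζ).2) ∈ c.target := by rw [hκ0]; exact hc.mem_target hζ
    have hγ0 : γ 0 = ζ := by simp only [γ, hκ0]; exact hc.symm_mk_snd hζ
    have hκc : ContMDiffAt 𝓘(ℝ, ℝ) ((𝓘(ℝ, EM).prod 𝓘(ℝ, FE)).prod 𝓘(ℝ, Y)) ∞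
        (fun ε => (κ ε, (c ζ).2)) 0 := hκ.contMDiffAt.prodMk contMDiffAt_const
    have hγ : ContMDiffAt 𝓘(ℝ, ℝ) (𝓘(ℝ, EG).prod 𝓘(ℝ, FV)) ∞ γ 0 :=
      ContMDiffAt.comp (0 : ℝ) (g := c.symm) (hc.contMDiffAt_symm hmem) hκc
    have hfγ : ∀ᶠ ε in 𝓝 (0 : ℝ), f (γ ε) = κ ε := by
      filter_upwards [hκc.continuousAt.preimage_mem_nhds (c.open_target.mem_nhds hmem)] with ε hε
      exact hc.apply_symm hε
    have hpr : ContMDiffAt 𝓘(ℝ, ℝ) 𝓘(ℝ, EG) ∞ (fun ε => (γ ε).proj) 0 :=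
      (contMDiff_proj VV).contMDiffAt.comp (0 : ℝ) hγ
    have hpr0 : (γ 0).proj = h₀ := by rw [hγ0]
    have hvs : ContMDiffAt 𝓘(ℝ, ℝ) 𝓘(ℝ, FV) ∞ (fun ε => (tV (γ ε)).2) 0 := by
      have h1 : ContMDiffAt 𝓘(ℝ, ℝ) (𝓘(ℝ, EG).prod 𝓘(ℝ, FV)) ∞ (fun ε => tV (γ ε)) 0 :=
        ContMDiffAt.comp (0 : ℝ) (g := tV) (hfV.contMDiffAt (tV.open_source.mem_nhds
          (tV.mem_source.2 (by rw [hpr0]; exact hmV)))) hγ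
      exact contMDiffAt_snd.comp _ h1
    have hv0 : (tV (γ 0)).2 = 0 := by
      rw [hγ0, tV.apply_eq_prod_continuousLinearEquivAt ℝ h₀ hmV]
      exact map_zero _
    have hAs : ContMDiffAt 𝓘(ℝ, ℝ) 𝓘(ℝ, FV →L[ℝ] FE) ∞ (fun ε => A (γ ε).proj) 0 :=
      ContMDiffAt.comp (0 : ℝ) (g := A) (hA _ (by rw [hpr0]; exact ⟨hmV, hmE⟩)) hpr
    -- The fibre coordinate of the lift vanishes at `0`, so the product rule loses the term with the
    -- derivative of `A`, leaving `A h₀` applied to a velocity, which equals `y`.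
    have hd1 := (hvs.contDiffAt.differentiableAt (by simp)).hasDerivAt
    have hd2 := (hAs.contDiffAt.differentiableAt (by simp)).hasDerivAt
    have hd := hd2.clm_apply hd1
    have hlin : HasDerivAt (fun ε => A (γ ε).proj (tV (γ ε)).2) y 0 := by
      have h1 : HasDerivAt (fun ε : ℝ => ε • y) y 0 := by
        simpa using (hasDerivAt_id (0 : ℝ)).smul_const y
      refine h1.congr_of_eventuallyEq ?_
      filter_upwards [hfγ, hpr.continuousAt.preimage_mem_nhds
        (hW.mem_nhds (by rw [hpr0]; exact ⟨hmV, hmE⟩))] with ε hε hεW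
      have hs : γ ε ∈ tV.source := tV.mem_source.2 hεW.1
      rw [← hTA _ hεW]
      have h2 : tV.toOpenPartialHomeomorph.symm ((γ ε).proj, (tV (γ ε)).2) = γ ε := by
        rw [tV.mk_proj_snd hs]
        exact tV.toOpenPartialHomeomorph.left_inv hs
      simp only [T, h2, hε]
      exact b.apply_symm_apply (ε • y)
    have heq := hd.unique hlin
    rw [hv0, map_zero, zero_add, hpr0] at heq
    exact ⟨_, heq⟩
  -- With a right inverse `R` of `A h₀`, the operator `A h ∘ R` is the identity at `h₀`, hence
  -- invertible nearby, and `R ∘ (A h ∘ R)⁻¹` is a right inverse of `A h` that is smooth in `h`.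
  obtain ⟨R, hR⟩ := (A h₀).toLinearMap.exists_rightInverse_of_surjective
    (LinearMap.range_eq_top.2 hsurj)
  let R' : FE →L[ℝ] FV := R.toContinuousLinearMap
  let B : G → FE →L[ℝ] FE := fun h => (A h).comp R'
  have hB : ∀ h ∈ W, ContMDiffAt 𝓘(ℝ, EG) 𝓘(ℝ, FE →L[ℝ] FE) ∞ B h := fun h hh =>
    (hA h hh).clm_comp contMDiffAt_const
  have hB₀ : B h₀ = 1 := by
    ext y
    exact LinearMap.congr_fun hR y
  let U : Set G := W ∩ B ⁻¹' {S | IsUnit S}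
  have hU : IsOpen U := by
    have : ContinuousOn B W := fun h hh => (hB h hh).continuousAt.continuousWithinAt
    exact this.isOpen_inter_preimage hW Units.isOpen
  refine ⟨fun e h => tV.toOpenPartialHomeomorph.symm (h, R' (Ring.inverse (B h) (tE e).2)), U, hU,
    ⟨⟨hmV, hmE⟩, ?_⟩, ?_, ?_⟩
  · simp [hB₀]
  · intro h hh e he
    refine ⟨hsymm hh.1.1, ?_⟩
    have heE : e ∈ tE.source := tE.mem_source.2 (by rw [he]; exact hh.1.2)
    set ζ := f (tV.toOpenPartialHomeomorph.symm (h, R' (Ring.inverse (B h) (tE e).2))) with hζ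
    have hζp : ζ.proj = e.proj := by rw [hζ, hproj, hsymm hh.1.1, he]
    have hζE : ζ ∈ tE.source := tE.mem_source.2 (by rw [hζp, he]; exact hh.1.2)
    have hsnd : (tE ζ).2 = (tE e).2 := by
      have h1 := hTA h hh.1 (R' (Ring.inverse (B h) (tE e).2))
      have h2 : B h (Ring.inverse (B h) (tE e).2) = (tE e).2 := by
        have := Ring.mul_inverse_cancel (B h) hh.2
        exact congrArg (fun S : FE →L[ℝ] FE => S (tE e).2) this
      exact h1.trans h2
    refine tE.injOn hζE heE (Prod.ext ?_ hsnd)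
    exact (tE.coe_fst hζE).trans (hζp.trans (tE.coe_fst heE).symm)
  · intro h hh e he
    have heE : e ∈ tE.source := tE.mem_source.2 (by rw [he]; exact hh.1.2)
    have h1 : ContMDiffAt ((𝓘(ℝ, EM).prod 𝓘(ℝ, FE)).prod 𝓘(ℝ, EG)) 𝓘(ℝ, FE) ∞
        (fun q : TotalSpace FE EE × G => (tE q.1).2) (e, h) :=
      contMDiffAt_snd.comp _ (ContMDiffAt.comp (e, h) (g := tE)
        (hfE.contMDiffAt (tE.open_source.mem_nhds heE)) contMDiffAt_fst)
    have h2 : ContMDiffAt ((𝓘(ℝ, EM).prod 𝓘(ℝ, FE)).prod 𝓘(ℝ, EG)) 𝓘(ℝ, FE →L[ℝ] FE) ∞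
        (fun q : TotalSpace FE EE × G => Ring.inverse (B q.2)) (e, h) := by
      obtain ⟨S, hS⟩ := hh.2
      have h3 : ContDiffAt ℝ ∞ Ring.inverse (B h) := by
        rw [← hS]; exact contDiffAt_ringInverse ℝ S
      exact ContMDiffAt.comp (e, h) (g := Ring.inverse) h3.contMDiffAt
        (ContMDiffAt.comp (e, h) (g := B) (hB h hh.1) contMDiffAt_snd)
    have h4 : ContMDiffAt ((𝓘(ℝ, EM).prod 𝓘(ℝ, FE)).prod 𝓘(ℝ, EG)) 𝓘(ℝ, FV) ∞
        (fun q : TotalSpace FE EE × G => R' (Ring.inverse (B q.2) (tE q.1).2)) (e, h) :=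
      R'.contMDiff.contMDiffAt.comp (e, h) (h2.clm_apply h1)
    exact ContMDiffAt.comp (e, h) (g := tV.toOpenPartialHomeomorph.symm)
      (hsV.contMDiffAt (tV.open_target.mem_nhds (tV.mem_target.2 hh.1.1)))
      (contMDiffAt_snd.prodMk h4)

end BundleMaps

/-! ### Local parametrizations of composable strings -/

namespace LieGroupoid

section Snoc

variable {EM HM EG HG : Type*}
  [NormedAddCommGroup EM] [NormedSpace ℝ EM] [TopologicalSpace HM]
  [NormedAddCommGroup EG] [NormedSpace ℝ EG] [TopologicalSpace HG]
  {J : ModelWithCorners ℝ EM HM} {M : Type u} [TopologicalSpace M] [ChartedSpace HM M]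
  {I : ModelWithCorners ℝ EG HG} {G : Type u} [TopologicalSpace G] [ChartedSpace HG G]
  {𝒢 : LieGroupoid J M I G} {n : ℕ}

theorem Composable.snoc {z : Fin (n + 1) → G} (hz : 𝒢.Composable z) {g : G}
    (hg : 𝒢.src (z (Fin.last n)) = 𝒢.tgt g) :
    𝒢.Composable (Fin.snoc (α := fun _ => G) z g : Fin (n + 2) → G) := by
  intro i
  refine Fin.lastCases ?_ (fun j => ?_) i
  · rw [Fin.snoc_castSucc, Fin.succ_last, Fin.snoc_last]
    exact hg
  · rw [Fin.snoc_castSucc, Fin.succ_castSucc, Fin.snoc_castSucc]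
    exact hz j

theorem Composable.init {z : Fin (n + 2) → G} (hz : 𝒢.Composable z) :
    𝒢.Composable (fun i : Fin (n + 1) => z i.castSucc) := fun i => hz i.castSucc

theorem contMDiffWithinAt_snoc {E H N : Type*} [NormedAddCommGroup E] [NormedSpace ℝ E]
    [TopologicalSpace H] {I' : ModelWithCorners ℝ E H} [TopologicalSpace N] [ChartedSpace H N]
    {f : N → Fin (n + 1) → G} {k : N → G} {s : Set N} {x : N}
    (hf : ContMDiffWithinAt I' (ModelWithCorners.pi fun _ : Fin (n + 1) => I) ∞ f s x)
    (hk : ContMDiffWithinAt I' I ∞ k s x) :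
    ContMDiffWithinAt I' (ModelWithCorners.pi fun _ : Fin (n + 2) => I) ∞
      (fun y => (Fin.snoc (α := fun _ => G) (f y) (k y) : Fin (n + 2) → G)) s x := by
  refine contMDiffWithinAt_pi_iff.2 fun i => ?_
  refine Fin.lastCases ?_ (fun j => ?_) i
  · simpa only [Fin.snoc_last] using hk
  · simpa only [Fin.snoc_castSucc] using contMDiffWithinAt_pi_iff.1 hf j

end Snoc

/-- Locally, the composable strings are the image of an open subset of a normed space under a
smooth map with a smooth left inverse. -/
theorem Composable.exists_parametrization {EM HM HG : Type*} {EG : Type w}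
    [NormedAddCommGroup EM] [NormedSpace ℝ EM] [TopologicalSpace HM]
    [NormedAddCommGroup EG] [NormedSpace ℝ EG] [TopologicalSpace HG]
    {J : ModelWithCorners ℝ EM HM} {M : Type u} [TopologicalSpace M] [ChartedSpace HM M]
    {I : ModelWithCorners ℝ EG HG} [I.Boundaryless]
    {G : Type u} [TopologicalSpace G] [ChartedSpace HG G] [IsManifold I ∞ G]
    {𝒢 : LieGroupoid J M I G} {n : ℕ} {z₀ : Fin (n + 1) → G} (hz₀ : 𝒢.Composable z₀) :
    ∃ (P : Type w) (_ : NormedAddCommGroup P) (_ : NormedSpace ℝ P)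
      (Q : P → Fin (n + 1) → G) (q : (Fin (n + 1) → G) → P) (O : Set P),
      IsOpen O ∧ q z₀ ∈ O ∧
      ContMDiffOn 𝓘(ℝ, P) (ModelWithCorners.pi fun _ : Fin (n + 1) => I) ∞ Q O ∧
      (∀ p ∈ O, 𝒢.Composable (Q p)) ∧
      ContMDiffAt (ModelWithCorners.pi fun _ : Fin (n + 1) => I) 𝓘(ℝ, P) ∞ q z₀ ∧
      ∀ᶠ z in 𝓝 z₀, 𝒢.Composable z → Q (q z) = z := by
  induction n with
  | zero =>
    refine ⟨EG, inferInstance, inferInstance, fun p _ => (extChartAt I (z₀ 0)).symm p,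
      fun z => extChartAt I (z₀ 0) (z 0), (extChartAt I (z₀ 0)).target,
      isOpen_extChartAt_target (z₀ 0), mem_extChartAt_target (z₀ 0), ?_, ?_, ?_, ?_⟩
    · exact fun p hp => contMDiffWithinAt_pi_iff.2 fun _ => contMDiffOn_extChartAt_symm _ p hp
    · exact fun p _ i => i.elim0
    · exact ContMDiffAt.comp z₀ (g := extChartAt I (z₀ 0)) contMDiffAt_extChartAt
        (contMDiffAt_eval (J := fun _ : Fin 1 => I) 0 z₀)
    · have h : ∀ᶠ z in 𝓝 z₀, z 0 ∈ (extChartAt I (z₀ 0)).source :=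
        (continuous_apply (0 : Fin 1)).continuousAt.preimage_mem_nhds
          (extChartAt_source_mem_nhds (z₀ 0))
      filter_upwards [h] with z hz _
      funext i
      obtain rfl : i = 0 := Fin.fin_one_eq_zero i
      exact (extChartAt I (z₀ 0)).left_inv hz
  | succ n ih =>
    obtain ⟨P, _, _, Q, q, O, hO, hqO, hQ, hQc, hq, hQq⟩ := ih hz₀.init
    obtain ⟨Y, _, _, hY⟩ := 𝒢.isSubmersion_tgt
    obtain ⟨e, he, hze⟩ := (hY (z₀ (Fin.last (n + 1)))).exists_isFibreChart
    -- Once the earlier arrows are given, the last arrow ranges over the target fibre at the source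
    -- of its predecessor, which a fibre chart parametrizes by `Y`.
    let r : P × Y → M × Y := fun p => (𝒢.src (Q p.1 (Fin.last n)), p.2)
    have hr : ContMDiffOn (𝓘(ℝ, P).prod 𝓘(ℝ, Y)) (J.prod 𝓘(ℝ, Y)) ∞ r (O ×ˢ Set.univ) := by
      refine ContMDiffOn.prodMk ?_ contMDiff_snd.contMDiffOn
      have h1 : ContMDiffOn 𝓘(ℝ, P) I ∞ (fun p => Q p (Fin.last n)) O :=
        fun p hp => contMDiffWithinAt_pi_iff.1 (hQ p hp) _
      exact 𝒢.isSubmersion_src.contMDiff.comp_contMDiffOn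
        (h1.comp contMDiff_fst.contMDiffOn fun p hp => hp.1)
    let O' : Set (P × Y) := (O ×ˢ Set.univ) ∩ r ⁻¹' e.target
    have hO' : IsOpen O' :=
      hr.continuousOn.isOpen_inter_preimage (hO.prod isOpen_univ) e.open_target
    have hinit : Continuous fun z : Fin (n + 2) → G => fun i : Fin (n + 1) => z i.castSucc := by
      fun_prop
    have hQq' := (hinit.continuousAt (x := z₀)).eventually hQq
    have hcomp : 𝒢.src (z₀ (Fin.last n).castSucc) = 𝒢.tgt (z₀ (Fin.last (n + 1))) :=
      hz₀ (Fin.last n)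
    refine ⟨P × Y, inferInstance, inferInstance,
      fun p => Fin.snoc (α := fun _ => G) (Q p.1) (e.symm (r p)),
      fun z => (q fun i => z i.castSucc, (e (z (Fin.last (n + 1)))).2), O', hO', ?_, ?_, ?_, ?_, ?_⟩
    · refine ⟨⟨hqO, trivial⟩, ?_⟩
      simp only [Set.mem_preimage, r, hQq.self_of_nhds hz₀.init, hcomp]
      exact he.mem_target hze
    · suffices h : ContMDiffOn (𝓘(ℝ, P).prod 𝓘(ℝ, Y))
          (ModelWithCorners.pi fun _ : Fin (n + 2) => I) ∞
          (fun p : P × Y => (Fin.snoc (α := fun _ => G) (Q p.1) (e.symm (r p)) :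
            Fin (n + 2) → G)) O' by
        rw [← modelWithCornersSelf_prod, chartedSpaceSelf_prod] at h
        exact h
      intro p hp
      refine contMDiffWithinAt_snoc ?_ ?_
      · exact (hQ p.1 hp.1.1).comp p contMDiffWithinAt_fst fun x hx => hx.1.1
      · exact (he.contMDiffOn_symm _ hp.2).comp p
          ((hr p hp.1).mono Set.inter_subset_left) fun x hx => hx.2
    · intro p hp
      exact (hQc p.1 hp.1.1).snoc (he.apply_symm hp.2).symm
    · refine ContMDiffAt.prodMk_space ?_ ?_
      · refine ContMDiffAt.comp z₀ (g := q) hq (contMDiffAt_pi_iff.2 fun i => ?_)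
        exact contMDiffAt_eval (J := fun _ : Fin (n + 2) => I) i.castSucc z₀
      · have h1 : ContMDiffAt (ModelWithCorners.pi fun _ : Fin (n + 2) => I) (J.prod 𝓘(ℝ, Y)) ∞
            (fun z : Fin (n + 2) → G => e (z (Fin.last (n + 1)))) z₀ :=
          ContMDiffAt.comp z₀ (g := e) (he.contMDiffAt hze)
            (contMDiffAt_eval (J := fun _ : Fin (n + 2) => I) (Fin.last (n + 1)) z₀)
        exact contMDiffAt_snd.comp _ h1
    · have h : ∀ᶠ z in 𝓝 z₀, z (Fin.last (n + 1)) ∈ e.source :=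
        (continuous_apply (Fin.last (n + 1))).continuousAt.preimage_mem_nhds
          (e.open_source.mem_nhds hze)
      filter_upwards [hQq', h] with z hz1 hz2 hz
      have h1 := hz1 hz.init
      have h2 : 𝒢.src (z (Fin.last n).castSucc) = 𝒢.tgt (z (Fin.last (n + 1))) := hz (Fin.last n)
      simp only [r, h1, h2, he.symm_mk_snd hz2]
      exact Fin.snoc_init_self (α := fun _ => G) z

end LieGroupoid

/-! ### Faces of a string with an appended arrow -/

section ContractNth

variable {α : Type*} {n : ℕ}

theorem Fin.contractNth_snoc_castSucc (op : α → α → α) (z : Fin (n + 2) → α) (a : α)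
    (j : Fin (n + 1)) :
    Fin.contractNth j.castSucc.castSucc op (Fin.snoc (α := fun _ => α) z a : Fin (n + 3) → α) =
      (Fin.snoc (α := fun _ => α) (Fin.contractNth j.castSucc op z) a : Fin (n + 2) → α) := by
  funext k
  refine Fin.lastCases ?_ (fun k => ?_) k
  · have h1 : ¬ ((Fin.last (n + 1) : ℕ) < j) := by have := j.2; rw [Fin.val_last]; omega
    have h2 : ¬ ((Fin.last (n + 1) : ℕ) = j) := by have := j.2; rw [Fin.val_last]; omega
    simp only [Fin.contractNth, Fin.val_castSucc, h1, h2, if_false, Fin.succ_last, Fin.snoc_last]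
  · simp only [Fin.contractNth, Fin.val_castSucc, Fin.snoc_castSucc, Fin.succ_castSucc]

theorem Fin.contractNth_snoc_last_castSucc (op : α → α → α) (z : Fin (n + 1) → α) (a : α) :
    Fin.contractNth (Fin.last n).castSucc op (Fin.snoc (α := fun _ => α) z a : Fin (n + 2) → α) =
      (Fin.snoc (α := fun _ => α) (fun i => z i.castSucc) (op (z (Fin.last n)) a) :
        Fin (n + 1) → α) := by
  funext k
  refine Fin.lastCases ?_ (fun k => ?_) k
  · simp only [Fin.contractNth, Fin.val_castSucc, lt_irrefl, if_false, if_true, Fin.snoc_castSucc,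
      Fin.succ_last, Fin.snoc_last]
  · have h1 : (k : ℕ) < Fin.last n := by simp
    simp only [Fin.contractNth, Fin.val_castSucc, h1, if_true, Fin.snoc_castSucc]

theorem Fin.contractNth_last (op : α → α → α) (z : Fin (n + 1) → α) :
    Fin.contractNth (Fin.last n) op z = fun i => z i.castSucc := by
  funext k
  have h1 : (k : ℕ) < Fin.last n := by simp
  simp only [Fin.contractNth, h1, if_true]

end ContractNth

/-- Linear operations respect equalities in the total space, although the two fibres are over base
points that are equal only by proof. -/
theorem Bundle.TotalSpace.mk_add_smul_eq {B F : Type*} {W : B → Type*} [∀ b, AddCommGroup (W b)]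
    [∀ b, Module ℝ (W b)] {x y : B} {a a' : W x} {b b' : W y}
    (h : (⟨x, a⟩ : TotalSpace F W) = ⟨y, b⟩) (h' : (⟨x, a'⟩ : TotalSpace F W) = ⟨y, b'⟩) (r s : ℝ) :
    (⟨x, r • a + s • a'⟩ : TotalSpace F W) = ⟨y, r • b + s • b'⟩ := by
  obtain rfl : x = y := congrArg TotalSpace.proj h
  rw [TotalSpace.mk_inj.1 h, TotalSpace.mk_inj.1 h']

namespace LieGroupoid

variable {EM HM EG HG : Type*}
  [NormedAddCommGroup EM] [NormedSpace ℝ EM] [TopologicalSpace HM]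
  [NormedAddCommGroup EG] [NormedSpace ℝ EG] [TopologicalSpace HG]
  {J : ModelWithCorners ℝ EM HM} {M : Type u} [TopologicalSpace M] [ChartedSpace HM M]
  {I : ModelWithCorners ℝ EG HG} {G : Type u} [TopologicalSpace G] [ChartedSpace HG G]
  {𝒢 : LieGroupoid J M I G} {n : ℕ}

theorem delta_apply (φ : 𝒢.Nerve n → ℝ) (g : 𝒢.Nerve (n + 1)) :
    𝒢.delta n φ g = ∑ i : Fin (n + 2), (-1 : ℝ) ^ (i : ℕ) * φ (𝒢.face n i g) := by
  simp [delta, LinearMap.sum_apply, Finset.sum_apply, LinearMap.funLeft_apply]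

/-- Append an arrow to a composable string. -/
def snocNerve (g : 𝒢.Nerve (n + 1)) (h : G) (hgh : 𝒢.src (g.1 (Fin.last n)) = 𝒢.tgt h) :
    𝒢.Nerve (n + 2) :=
  ⟨Fin.snoc (α := fun _ => G) g.1 h, g.2.snoc hgh⟩

theorem face_last (g : 𝒢.Nerve (n + 2)) :
    𝒢.face (n + 1) (Fin.last (n + 2)) g = ⟨fun i => g.1 i.castSucc, g.2.init⟩ :=
  Subtype.ext (Fin.contractNth_last 𝒢.mul g.1)

theorem face_last_snocNerve (g : 𝒢.Nerve (n + 1)) (h : G)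
    (hgh : 𝒢.src (g.1 (Fin.last n)) = 𝒢.tgt h) :
    𝒢.face (n + 1) (Fin.last (n + 2)) (snocNerve g h hgh) = g := by
  rw [face_last]
  refine Subtype.ext (funext fun i => ?_)
  simp [snocNerve]

theorem face_castSucc_last_snocNerve_val (g : 𝒢.Nerve (n + 2)) (h : G)
    (hgh : 𝒢.src (g.1 (Fin.last (n + 1))) = 𝒢.tgt h) :
    (𝒢.face (n + 2) (Fin.last (n + 2)).castSucc (snocNerve g h hgh)).1 =
      (Fin.snoc (α := fun _ => G) (fun i => g.1 i.castSucc) (𝒢.mul (g.1 (Fin.last (n + 1))) h) :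
        Fin (n + 2) → G) :=
  Fin.contractNth_snoc_last_castSucc 𝒢.mul g.1 h

theorem face_castSucc_castSucc_snocNerve_val (g : 𝒢.Nerve (n + 2)) (h : G)
    (hgh : 𝒢.src (g.1 (Fin.last (n + 1))) = 𝒢.tgt h) (j : Fin (n + 2)) :
    (𝒢.face (n + 2) j.castSucc.castSucc (snocNerve g h hgh)).1 =
      (Fin.snoc (α := fun _ => G) (𝒢.face (n + 1) j.castSucc g).1 h : Fin (n + 2) → G) := by
  refine Fin.cases ?_ (fun j => ?_) j
  · funext k
    change (Fin.snoc (α := fun _ => G) g.1 h : Fin (n + 3) → G) k.succ =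
      (Fin.snoc (α := fun _ => G) (fun i => g.1 i.succ) h : Fin (n + 2) → G) k
    refine Fin.lastCases ?_ (fun k => ?_) k
    · rw [Fin.succ_last, Fin.snoc_last, Fin.snoc_last]
    · rw [Fin.succ_castSucc, Fin.snoc_castSucc, Fin.snoc_castSucc]
  · exact Fin.contractNth_snoc_castSucc 𝒢.mul g.1 h j

theorem src_face_castSucc_last (g : 𝒢.Nerve (n + 2)) (j : Fin (n + 2)) :
    𝒢.src ((𝒢.face (n + 1) j.castSucc g).1 (Fin.last n)) = 𝒢.src (g.1 (Fin.last (n + 1))) := by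
  -- Appending the unit at the source and using composability of the face of the longer string
  -- avoids any distinction of cases on `j`.
  have h := (𝒢.tgt_one (𝒢.src (g.1 (Fin.last (n + 1))))).symm
  have h1 := (𝒢.face (n + 2) j.castSucc.castSucc (snocNerve g _ h)).2 (Fin.last n)
  rw [face_castSucc_castSucc_snocNerve_val, Fin.snoc_castSucc, Fin.succ_last, Fin.snoc_last] at h1
  rw [h1, ← h]

end LieGroupoid

/-! ### Cochains depend on their last vector through its base arrow only -/

namespace VBGroupoid

variable {EM EG : Type*}
  [NormedAddCommGroup EM] [NormedSpace ℝ EM] [NormedAddCommGroup EG] [NormedSpace ℝ EG]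
  {M : Type u} [TopologicalSpace M] [ChartedSpace EM M]
  {G : Type u} [TopologicalSpace G] [ChartedSpace EG G]
  {𝒢 : LieGroupoid 𝓘(ℝ, EM) M 𝓘(ℝ, EG) G}
  {FE : Type*} [NormedAddCommGroup FE] [NormedSpace ℝ FE]
  {EE : M → Type u} [∀ x, AddCommGroup (EE x)] [∀ x, Module ℝ (EE x)]
  [∀ x, TopologicalSpace (EE x)] [TopologicalSpace (TotalSpace FE EE)] [FiberBundle FE EE]
  [VectorBundle ℝ FE EE]
  {FV : Type*} [NormedAddCommGroup FV] [NormedSpace ℝ FV]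
  {VV : G → Type u} [∀ g, AddCommGroup (VV g)] [∀ g, Module ℝ (VV g)]
  [∀ g, TopologicalSpace (VV g)] [TopologicalSpace (TotalSpace FV VV)] [FiberBundle FV VV]
  [VectorBundle ℝ FV VV]
  {𝒱 : VBGroupoid 𝒢 FE EE FV VV} {n : ℕ}

/-- The composable strings over a fixed string of arrows form a linear space. -/
theorem composable_add_smul {g : Fin (n + 1) → G} {v v' : ∀ i, VV (g i)}
    (hv : 𝒱.Composable fun i => (⟨g i, v i⟩ : TotalSpace FV VV))
    (hv' : 𝒱.Composable fun i => (⟨g i, v' i⟩ : TotalSpace FV VV)) (r s : ℝ) :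
    𝒱.Composable fun i => (⟨g i, r • v i + s • v' i⟩ : TotalSpace FV VV) := by
  intro i
  obtain ⟨S, hS⟩ := exists_linearMap_of_homogeneous 𝒱.isSubmersion_src.contMDiff 𝒱.proj_src
    𝒱.src_scale (g i.castSucc)
  obtain ⟨T, hT⟩ := exists_linearMap_of_homogeneous 𝒱.isSubmersion_tgt.contMDiff 𝒱.proj_tgt
    𝒱.tgt_scale (g i.succ)
  have h := hv i
  have h' := hv' i
  simp only [hS, hT, map_add, map_smul] at h h' ⊢
  exact Bundle.TotalSpace.mk_add_smul_eq h h' r s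

/-- A cochain depends on its first argument and on the base points of the others only. -/
theorem cochain_eq_of_proj_eq {φ : 𝒱.Nerve (n + 1) → ℝ} (hφ : φ ∈ 𝒱.cochains (n + 1))
    {ξ η : 𝒱.Nerve (n + 1)} (h0 : ξ.1 0 = η.1 0) (hproj : ∀ i, (ξ.1 i).proj = (η.1 i).proj) :
    φ ξ = φ η := by
  obtain ⟨⟨F, hF, hφF⟩, -, hhom, hzero, -⟩ := hφ
  obtain ⟨ξ, hξ⟩ := ξ
  obtain ⟨η, hη⟩ := η
  obtain ⟨g, v, rfl⟩ : ∃ (g : Fin (n + 1) → G) (v : ∀ i, VV (g i)), ξ = fun i => ⟨g i, v i⟩ :=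
    ⟨fun i => (ξ i).proj, fun i => (ξ i).2, rfl⟩
  obtain ⟨v', rfl⟩ : ∃ v' : ∀ i, VV (g i), η = fun i => ⟨g i, v' i⟩ := by
    have : ∀ i, ∃ w : VV (g i), η i = ⟨g i, w⟩ := fun i => by
      have h : g i = (η i).proj := hproj i
      generalize η i = ζ at h
      obtain ⟨x, z⟩ := ζ
      obtain rfl : g i = x := h
      exact ⟨z, rfl⟩
    choose w hw using this
    exact ⟨w, funext hw⟩
  -- The plane spanned by the two strings; on it the cochain is smooth and homogeneous, hence
  -- linear.
  let γ : ℝ × ℝ → Fin (n + 1) → TotalSpace FV VV := fun p i => ⟨g i, p.1 • v i + p.2 • v' i⟩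
  have hγ : ∀ p, 𝒱.Composable (γ p) := fun p => composable_add_smul hξ hη p.1 p.2
  have hγs : ContMDiff 𝓘(ℝ, ℝ × ℝ)
      (ModelWithCorners.pi fun _ : Fin (n + 1) => 𝓘(ℝ, EG).prod 𝓘(ℝ, FV)) ∞ γ := fun p =>
    contMDiffAt_pi_iff.2 fun i => (contMDiff_totalSpace_mk (g i) (by
      simp only [map_add, map_smul]
      fun_prop)).contMDiffAt
  let f : ℝ × ℝ → ℝ := fun p => F (γ p)
  have hf : ContDiff ℝ ∞ f :=
    (contMDiffOn_univ.1 (hF.comp hγs.contMDiffOn fun p _ => hγ p)).contDiff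
  have hlin := eq_fderiv_of_homogeneous (f := f) (hf.differentiable (by simp) 0) (by
    intro r hr p
    have h : F (fun i => fibreScale FV r (γ p i)) = r * F (γ p) :=
      (hφF _).symm.trans ((hhom r hr ⟨γ p, hγ p⟩).trans (congrArg (r * ·) (hφF _)))
    rw [smul_eq_mul, ← h]
    refine congrArg F (funext fun i => ?_)
    simp [γ, fibreScale, smul_smul])
  -- The difference of the two strings begins with a zero vector, so condition 1 applies.
  have h1 : f (1, -1) = 0 := by
    refine (hφF ⟨γ (1, -1), hγ _⟩).symm.trans (hzero (g 0) ⟨γ (1, -1), hγ _⟩ ?_)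
    have : v 0 = v' 0 := TotalSpace.mk_inj.1 h0
    simp [γ, zeroSection, this]
  have h2 : φ ⟨_, hξ⟩ = f (1, 0) :=
    (hφF _).trans (congrArg F (funext fun i => by simp [γ]))
  have h3 : φ ⟨_, hη⟩ = f (0, 1) :=
    (hφF _).trans (congrArg F (funext fun i => by simp [γ]))
  refine h2.trans (Eq.trans ?_ h3.symm)
  rw [← sub_eq_zero, hlin (1, 0), hlin (0, 1), ← map_sub, ← hlin]
  simpa using h1

theorem exists_lift_tgt [FiniteDimensional ℝ FE] [FiniteDimensional ℝ FV]
    [IsManifold 𝓘(ℝ, EM) ∞ M] [IsManifold 𝓘(ℝ, EG) ∞ G]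
    [ContMDiffVectorBundle ∞ FE EE 𝓘(ℝ, EM)] [ContMDiffVectorBundle ∞ FV VV 𝓘(ℝ, EG)]
    (𝒱 : VBGroupoid 𝒢 FE EE FV VV) {h : G} {e : TotalSpace FE EE} (he : 𝒢.tgt h = e.proj) :
    ∃ η : TotalSpace FV VV, η.proj = h ∧ e = 𝒱.tgt η := by
  obtain ⟨σ, U, -, hU, hσ, -⟩ := exists_local_lift 𝒱.isSubmersion_tgt
    𝒢.isSubmersion_tgt.contMDiff 𝒱.proj_tgt 𝒱.tgt_scale h
  obtain ⟨h1, h2⟩ := hσ h hU e he.symm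
  exact ⟨σ e h, h1, h2.symm⟩

open Classical in
/-- The value of a cochain on a string whose last argument is any vector over a given arrow. -/
def lastEval (φ : 𝒱.Nerve (n + 2) → ℝ) (z : Fin (n + 1) → TotalSpace FV VV) (h : G) : ℝ :=
  if H : ∃ η : TotalSpace FV VV, η.proj = h ∧
      𝒱.Composable (Fin.snoc (α := fun _ => TotalSpace FV VV) z η : Fin (n + 2) → _)
    then φ ⟨_, H.choose_spec.2⟩ else 0

/-- The choice in `lastEval` is immaterial: two extensions share the first entry, since the string
has at least two entries, and they have the same base points. -/
theorem lastEval_eq {φ : 𝒱.Nerve (n + 2) → ℝ} (hφ : φ ∈ 𝒱.cochains (n + 2))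
    {z : Fin (n + 1) → TotalSpace FV VV} {h : G} {η : TotalSpace FV VV} (hη : η.proj = h)
    (hz : 𝒱.Composable (Fin.snoc (α := fun _ => TotalSpace FV VV) z η : Fin (n + 2) → _)) :
    lastEval φ z h = φ ⟨_, hz⟩ := by
  have H : ∃ η : TotalSpace FV VV, η.proj = h ∧
      𝒱.Composable (Fin.snoc (α := fun _ => TotalSpace FV VV) z η : Fin (n + 2) → _) := ⟨η, hη, hz⟩
  rw [lastEval, dif_pos H]
  refine cochain_eq_of_proj_eq hφ ?_ fun i => ?_
  · simp only [← Fin.castSucc_zero, Fin.snoc_castSucc]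
  · refine Fin.lastCases ?_ (fun j => ?_) i
    · simp only [Fin.snoc_last, hη, H.choose_spec.1]
    · simp only [Fin.snoc_castSucc]

theorem lastEval_snocNerve {φ : 𝒱.Nerve (n + 2) → ℝ} (hφ : φ ∈ 𝒱.cochains (n + 2))
    (ξ : 𝒱.Nerve (n + 1)) (η : TotalSpace FV VV)
    (h : 𝒱.src (ξ.1 (Fin.last n)) = 𝒱.tgt η) :
    lastEval φ ξ.1 η.proj = φ (LieGroupoid.snocNerve ξ η h) :=
  lastEval_eq hφ rfl _

variable [FiniteDimensional ℝ FE] [FiniteDimensional ℝ FV]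
  [IsManifold 𝓘(ℝ, EM) ∞ M] [IsManifold 𝓘(ℝ, EG) ∞ G]
  [ContMDiffVectorBundle ∞ FE EE 𝓘(ℝ, EM)] [ContMDiffVectorBundle ∞ FV VV 𝓘(ℝ, EG)]

/-- Independence of the chosen vector allows a local smooth lift of the required target to be used
instead, which exhibits the function as a composite of smooth maps. -/
theorem contMDiffOn_lastEval {φ : 𝒱.Nerve (n + 2) → ℝ} (hφ : φ ∈ 𝒱.cochains (n + 2))
    {P : Type*} [NormedAddCommGroup P] [NormedSpace ℝ P] {O : Set P}
    {Q : P → Fin (n + 1) → TotalSpace FV VV}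
    (hQ : ContMDiffOn 𝓘(ℝ, P)
      (ModelWithCorners.pi fun _ : Fin (n + 1) => 𝓘(ℝ, EG).prod 𝓘(ℝ, FV)) ∞ Q O)
    (hQc : ∀ p ∈ O, 𝒱.Composable (Q p)) :
    ContMDiffOn (𝓘(ℝ, P).prod 𝓘(ℝ, EG)) 𝓘(ℝ, ℝ) ∞
      (fun q : P × G => lastEval (𝒱 := 𝒱) φ (Q q.1) q.2)
      {q | q.1 ∈ O ∧ 𝒢.tgt q.2 = 𝒢.src (Q q.1 (Fin.last n)).proj} := by
  obtain ⟨F, hF, hφF⟩ := hφ.1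
  rintro ⟨p₀, h₀⟩ ⟨hp₀, hh₀⟩
  obtain ⟨σ, U, hUo, hU, hσ, hσs⟩ := exists_local_lift 𝒱.isSubmersion_tgt
    𝒢.isSubmersion_tgt.contMDiff 𝒱.proj_tgt 𝒱.tgt_scale h₀
  set s : Set (P × G) := {q | q.1 ∈ O ∧ 𝒢.tgt q.2 = 𝒢.src (Q q.1 (Fin.last n)).proj} with hs
  let e : P × G → TotalSpace FE EE := fun q => 𝒱.src (Q q.1 (Fin.last n))
  have he : ∀ q ∈ s, (e q).proj = 𝒢.tgt q.2 := fun q hq => (𝒱.proj_src _).trans hq.2.symm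
  let Z : P × G → Fin (n + 2) → TotalSpace FV VV := fun q =>
    Fin.snoc (α := fun _ => TotalSpace FV VV) (Q q.1) (σ (e q) q.2)
  have hZc : ∀ q ∈ s ∩ Prod.snd ⁻¹' U, 𝒱.Composable (Z q) := fun q hq =>
    (hQc q.1 hq.1.1).snoc (hσ q.2 hq.2 (e q) (he q hq.1)).2.symm
  have hQ' : ContMDiffWithinAt (𝓘(ℝ, P).prod 𝓘(ℝ, EG))
      (ModelWithCorners.pi fun _ : Fin (n + 1) => 𝓘(ℝ, EG).prod 𝓘(ℝ, FV)) ∞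
      (fun q : P × G => Q q.1) s (p₀, h₀) :=
    (hQ p₀ hp₀).comp (p₀, h₀) contMDiffWithinAt_fst fun q hq => hq.1
  have he' : ContMDiffWithinAt (𝓘(ℝ, P).prod 𝓘(ℝ, EG)) (𝓘(ℝ, EM).prod 𝓘(ℝ, FE)) ∞ e s (p₀, h₀) :=
    (𝒱.isSubmersion_src.contMDiff _).comp_contMDiffWithinAt (p₀, h₀)
      (contMDiffWithinAt_pi_iff.1 hQ' (Fin.last n))
  have hZ : ContMDiffWithinAt (𝓘(ℝ, P).prod 𝓘(ℝ, EG))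
      (ModelWithCorners.pi fun _ : Fin (n + 2) => 𝓘(ℝ, EG).prod 𝓘(ℝ, FV)) ∞ Z s (p₀, h₀) :=
    LieGroupoid.contMDiffWithinAt_snoc hQ'
      ((hσs h₀ hU (e (p₀, h₀)) (he _ ⟨hp₀, hh₀⟩)).comp_contMDiffWithinAt (p₀, h₀)
        (he'.prodMk contMDiffWithinAt_snd))
  have hnhds : Prod.snd ⁻¹' U ∈ 𝓝 (p₀, h₀) := (hUo.preimage continuous_snd).mem_nhds hU
  rw [← contMDiffWithinAt_inter hnhds]
  have hmem : (p₀, h₀) ∈ s ∩ Prod.snd ⁻¹' U := ⟨⟨hp₀, hh₀⟩, hU⟩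
  refine ((hF _ (hZc _ hmem)).comp (p₀, h₀) (hZ.mono Set.inter_subset_left) hZc).congr
    (fun q hq => ?_) ?_
  · exact (lastEval_eq hφ (hσ q.2 hq.2 (e q) (he q hq.1)).1 (hZc q hq)).trans (hφF _)
  · exact (lastEval_eq hφ (hσ h₀ hU (e (p₀, h₀)) (he _ hmem.1)).1 (hZc _ hmem)).trans (hφF _)

theorem continuousOn_lastEval {φ : 𝒱.Nerve (n + 2) → ℝ} (hφ : φ ∈ 𝒱.cochains (n + 2))
    (ξ : 𝒱.Nerve (n + 1)) :
    ContinuousOn (lastEval φ ξ.1) {h | 𝒢.tgt h = 𝒢.src (ξ.1 (Fin.last n)).proj} := by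
  have h := contMDiffOn_lastEval hφ (P := ℝ) (O := Set.univ) (Q := fun _ => ξ.1)
    contMDiffOn_const fun _ _ => ξ.2
  exact h.continuousOn.comp (f := fun h : G => ((0 : ℝ), h)) (by fun_prop)
    fun h hh => ⟨Set.mem_univ _, hh⟩

end VBGroupoid

/-! ### Averaging over the last argument as a contracting homotopy -/

namespace VBGroupoid

variable {EM : Type*} {EG : Type w}
  [NormedAddCommGroup EM] [NormedSpace ℝ EM] [NormedAddCommGroup EG] [NormedSpace ℝ EG]
  {M : Type u} [TopologicalSpace M] [ChartedSpace EM M]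
  {G : Type u} [TopologicalSpace G] [ChartedSpace EG G]
  {𝒢 : LieGroupoid 𝓘(ℝ, EM) M 𝓘(ℝ, EG) G}
  {FE : Type*} [NormedAddCommGroup FE] [NormedSpace ℝ FE]
  {EE : M → Type u} [∀ x, AddCommGroup (EE x)] [∀ x, Module ℝ (EE x)]
  [∀ x, TopologicalSpace (EE x)] [TopologicalSpace (TotalSpace FE EE)] [FiberBundle FE EE]
  [VectorBundle ℝ FE EE]
  {FV : Type w'} [NormedAddCommGroup FV] [NormedSpace ℝ FV]
  {VV : G → Type u} [∀ g, AddCommGroup (VV g)] [∀ g, Module ℝ (VV g)]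
  [∀ g, TopologicalSpace (VV g)] [TopologicalSpace (TotalSpace FV VV)] [FiberBundle FV VV]
  [VectorBundle ℝ FV VV]
  {𝒱 : VBGroupoid 𝒢 FE EE FV VV} {n : ℕ}

/-- Average a cochain over its last argument. -/
def averageLast (a : M → (G → ℝ) → ℝ) (φ : 𝒱.Nerve (n + 2) → ℝ) (ξ : 𝒱.Nerve (n + 1)) : ℝ :=
  a (𝒢.src (ξ.1 (Fin.last n)).proj) (lastEval φ ξ.1)

variable [FiniteDimensional ℝ FE] [FiniteDimensional ℝ FV]
  [IsManifold 𝓘(ℝ, EM) ∞ M] [IsManifold 𝓘(ℝ, EG) ∞ G]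
  [ContMDiffVectorBundle ∞ FE EE 𝓘(ℝ, EM)] [ContMDiffVectorBundle ∞ FV VV 𝓘(ℝ, EG)]
  {a : M → (G → ℝ) → ℝ}

/-- Averages are smooth in parameters from open subsets of normed spaces. Near a composable string
one pulls back along the parametrization `Q` and returns by `q`; that `Q ∘ q` is the identity on
composable strings suffices for smoothness along them. -/
theorem isSmooth_averageLast (ha : 𝒢.IsAverage.{u, max w w'} a) {φ : 𝒱.Nerve (n + 2) → ℝ}
    (hφ : φ ∈ 𝒱.cochains (n + 2)) : 𝒱.IsSmooth (n + 1) (averageLast a φ) := by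
  refine ⟨fun z => a (𝒢.src (z (Fin.last n)).proj) (lastEval φ z), fun z₀ hz₀ => ?_, fun _ => rfl⟩
  obtain ⟨P, _, _, Q, q, O, hO, hq₀, hQ, hQc, hq, hQq⟩ :=
    LieGroupoid.Composable.exists_parametrization (𝒢 := 𝒱.toLieGroupoid) hz₀
  have hr : ContMDiffOn 𝓘(ℝ, P) 𝓘(ℝ, EM) ∞ (fun p => 𝒢.src (Q p (Fin.last n)).proj) O :=
    fun p hp => (𝒢.isSubmersion_src.contMDiff _).comp_contMDiffWithinAt p
      ((contMDiff_proj VV _).comp_contMDiffWithinAt p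
        (contMDiffWithinAt_pi_iff.1 (hQ p hp) (Fin.last n)))
  have h := (ha.contDiffOn hO hr (Φ := fun p => lastEval φ (Q p))
    (contMDiffOn_lastEval hφ hQ hQc)).contMDiffOn.contMDiffAt (hO.mem_nhds hq₀)
  refine ((h.comp z₀ hq).contMDiffWithinAt.congr_of_eventuallyEq ?_ ?_)
  · filter_upwards [nhdsWithin_le_nhds hQq, self_mem_nhdsWithin] with z hz hzc
    simp only [Function.comp_apply, hz hzc]
  · simp only [Function.comp_apply, hQq.self_of_nhds hz₀]

/-- The average is determined by the values of the cochain on the extensions of a string. -/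
theorem averageLast_eq_mul (ha : 𝒢.IsAverage a) {φ : 𝒱.Nerve (n + 2) → ℝ}
    (hφ : φ ∈ 𝒱.cochains (n + 2)) {ξ ξ' : 𝒱.Nerve (n + 1)} {r : ℝ}
    (hsrc : 𝒢.src (ξ'.1 (Fin.last n)).proj = 𝒢.src (ξ.1 (Fin.last n)).proj)
    (h : ∀ η (hη : 𝒱.src (ξ.1 (Fin.last n)) = 𝒱.tgt η), ∃ η',
      η'.proj = η.proj ∧ ∃ hη' : 𝒱.src (ξ'.1 (Fin.last n)) = 𝒱.tgt η',
      φ (LieGroupoid.snocNerve ξ' η' hη') = r * φ (LieGroupoid.snocNerve ξ η hη)) :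
    averageLast a φ ξ' = r * averageLast a φ ξ := by
  -- Homogeneity of the average, again as linearity over a one-element index set.
  have h1 := ha.sum {()} (fun _ => r) (f := fun _ => lastEval φ ξ.1) fun _ _ =>
    continuousOn_lastEval hφ ξ
  simp only [Finset.sum_singleton] at h1
  rw [averageLast, averageLast, hsrc, ← h1]
  refine ha.congr fun g hg => ?_
  obtain ⟨η, rfl, hη⟩ := 𝒱.exists_lift_tgt (e := 𝒱.src (ξ.1 (Fin.last n)))
    (hg.trans (𝒱.proj_src _).symm)
  obtain ⟨η', hproj, hη', h⟩ := h η hη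
  rw [lastEval_snocNerve hφ ξ η hη, ← hproj, lastEval_snocNerve hφ ξ' η' hη', h]

theorem averageLast_eq_zero (ha : 𝒢.IsAverage a) {φ : 𝒱.Nerve (n + 2) → ℝ}
    (hφ : φ ∈ 𝒱.cochains (n + 2)) {ξ : 𝒱.Nerve (n + 1)}
    (h : ∀ η (hη : 𝒱.src (ξ.1 (Fin.last n)) = 𝒱.tgt η), φ (LieGroupoid.snocNerve ξ η hη) = 0) :
    averageLast a φ ξ = 0 := by
  rw [averageLast_eq_mul ha hφ (r := 0) rfl fun η hη => ⟨η, rfl, hη, by rw [h η hη, zero_mul]⟩,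
    zero_mul]

/-- Each condition on the average at `ξ` follows from the same condition on `φ` at all extensions of
`ξ`, because appending a vector leaves the entries concerned unchanged. For homogeneity the appended
vector is rescaled as well, which does not move its base arrow. -/
theorem averageLast_mem_cochains (ha : 𝒢.IsAverage.{u, max w w'} a) {φ : 𝒱.Nerve (n + 2) → ℝ}
    (hφ : φ ∈ 𝒱.cochains (n + 2)) : averageLast a φ ∈ 𝒱.cochains (n + 1) := by
  refine ⟨isSmooth_averageLast ha hφ, ?_, ?_, ?_, ?_⟩
  · rintro ξ ⟨i, x, hi⟩
    refine averageLast_eq_zero ha hφ fun η hη => hφ.2.1 _ ⟨i.castSucc, x, ?_⟩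
    rw [← hi]
    exact Fin.snoc_castSucc (α := fun _ => TotalSpace FV VV) _ _ _
  · intro r hr ξ
    refine averageLast_eq_mul ha hφ rfl fun η hη => ⟨fibreScale FV r η, rfl, ?_, ?_⟩
    · rw [𝒱.tgt_scale r hr, ← hη]
      exact 𝒱.src_scale r hr _
    · refine Eq.trans (congrArg φ (Subtype.ext (funext fun i => ?_)))
        (hφ.2.2.1 r hr (LieGroupoid.snocNerve ξ η hη))
      refine Fin.lastCases ?_ (fun j => ?_) i <;>
        simp [LieGroupoid.snocNerve, nerveScale]
  · intro g ξ hξ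
    refine averageLast_eq_zero ha hφ fun η hη => hφ.2.2.2.1 g _ ?_
    rw [← hξ]
    exact Fin.snoc_castSucc (α := fun _ => TotalSpace FV VV) η ξ.1 0
  · intro g ξ ξ' hg h0 hs
    -- For `n = 0` the last entry is the one multiplied by `0_g`, but left multiplication does not
    -- change its source, so both averages run over the same fibre.
    have hsrc : 𝒱.src (ξ'.1 (Fin.last n)) = 𝒱.src (ξ.1 (Fin.last n)) := by
      cases n with
      | zero => exact (congrArg 𝒱.src h0).trans (𝒱.src_mul _ _ hg)
      | succ n => exact congrArg 𝒱.src (hs (Fin.last n))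
    rw [← one_mul (averageLast a φ ξ)]
    refine averageLast_eq_mul ha hφ ?_ fun η hη => ⟨η, rfl, hsrc.trans hη, ?_⟩
    · rw [← 𝒱.proj_src, hsrc, 𝒱.proj_src]
    · rw [one_mul]
      refine hφ.2.2.2.2 g _ _ ?_ ?_ fun i => ?_
      · rw [hg]
        exact congrArg 𝒱.tgt (Fin.snoc_castSucc (α := fun _ => TotalSpace FV VV) η ξ.1 0).symm
      · refine (Fin.snoc_castSucc (α := fun _ => TotalSpace FV VV) η ξ'.1 0).trans (h0.trans ?_)
        exact congrArg (𝒱.mul _)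
          (Fin.snoc_castSucc (α := fun _ => TotalSpace FV VV) η ξ.1 0).symm
      · change (Fin.snoc (α := fun _ => TotalSpace FV VV) ξ'.1 η : Fin (n + 2) → _) i.succ =
          (Fin.snoc (α := fun _ => TotalSpace FV VV) ξ.1 η : Fin (n + 2) → _) i.succ
        refine Fin.lastCases ?_ (fun j => ?_) i
        · rw [Fin.succ_last, Fin.snoc_last, Fin.snoc_last]
        · rw [Fin.succ_castSucc, Fin.snoc_castSucc, Fin.snoc_castSucc, hs j]

/-- The average over the last argument is a contracting homotopy on cocycles. -/
theorem delta_averageLast (ha : 𝒢.IsAverage a) {φ : 𝒱.Nerve (n + 2) → ℝ}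
    (hφ : φ ∈ 𝒱.cocycles (n + 2)) :
    𝒱.delta (n + 1) (averageLast a φ) = (-1 : ℝ) ^ n • φ := by
  obtain ⟨hφ, hδ⟩ := hφ
  funext ξ
  set x := 𝒢.src (ξ.1 (Fin.last (n + 1))).proj with hx
  set g := (ξ.1 (Fin.last (n + 1))).proj with hg
  let ξ' : 𝒱.Nerve (n + 1) := ⟨fun i => ξ.1 i.castSucc, ξ.2.init⟩
  have hsrc : ∀ j : Fin (n + 2),
      𝒢.src ((𝒱.face (n + 1) j.castSucc ξ).1 (Fin.last n)).proj = x := fun j => by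
    rw [← 𝒱.proj_src, LieGroupoid.src_face_castSucc_last, 𝒱.proj_src]
  have hξ' : 𝒢.src (ξ'.1 (Fin.last n)).proj = 𝒢.tgt g := by
    rw [← 𝒱.proj_src, ← 𝒱.proj_tgt]
    exact congrArg TotalSpace.proj (ξ.2 (Fin.last n))
  -- The cocycle identity on `ξ` extended by a vector over `h`, with the last two faces moved to the
  -- right; hence their signs.
  have hcocycle : ∀ h, 𝒢.tgt h = x →
      ∑ j : Fin (n + 2), (-1 : ℝ) ^ (j : ℕ) * lastEval φ (𝒱.face (n + 1) j.castSucc ξ).1 h =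
        (-1 : ℝ) ^ n * φ ξ + (-1 : ℝ) ^ (n + 1) * lastEval φ ξ'.1 (𝒢.mul g h) := by
    intro h hh
    obtain ⟨η, rfl, hη⟩ := 𝒱.exists_lift_tgt (e := 𝒱.src (ξ.1 (Fin.last (n + 1))))
      (hh.trans (𝒱.proj_src _).symm)
    have h0 : 𝒱.delta (n + 2) φ (LieGroupoid.snocNerve ξ η hη) = 0 := congrFun hδ _
    have hj : ∀ j : Fin (n + 2),
        φ (𝒱.face (n + 2) j.castSucc.castSucc (LieGroupoid.snocNerve ξ η hη)) =
          lastEval φ (𝒱.face (n + 1) j.castSucc ξ).1 η.proj := fun j =>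
      (congrArg φ (Subtype.ext (LieGroupoid.face_castSucc_castSucc_snocNerve_val ξ η hη j))).trans
        (lastEval_snocNerve hφ _ η
          ((LieGroupoid.src_face_castSucc_last ξ j).trans hη)).symm
    have hm : φ (𝒱.face (n + 2) (Fin.last (n + 2)).castSucc (LieGroupoid.snocNerve ξ η hη)) =
        lastEval φ ξ'.1 (𝒢.mul g η.proj) := by
      rw [hg, ← 𝒱.proj_mul _ _ hη]
      exact (congrArg φ (Subtype.ext (LieGroupoid.face_castSucc_last_snocNerve_val ξ η hη))).trans
        (lastEval_snocNerve hφ ξ' (𝒱.mul (ξ.1 (Fin.last (n + 1))) η)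
          ((ξ.2 (Fin.last n)).trans (𝒱.tgt_mul _ _ hη).symm)).symm
    rw [LieGroupoid.delta_apply, Fin.sum_univ_castSucc, Fin.sum_univ_castSucc,
      LieGroupoid.face_last_snocNerve, hm] at h0
    simp only [hj, Fin.val_castSucc, Fin.val_last, pow_succ] at h0 ⊢
    linarith
  have hcont : ContinuousOn (lastEval φ ξ'.1) {h | 𝒢.tgt h = 𝒢.tgt g} := by
    rw [← hξ']
    exact continuousOn_lastEval hφ ξ'
  have hcont_mul : ContinuousOn (fun h => lastEval φ ξ'.1 (𝒢.mul g h)) {h | 𝒢.tgt h = x} :=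
    hcont.comp (𝒢.contMDiffOn_mul.continuousOn.comp (f := fun h : G => (g, h)) (by fun_prop)
      fun h hh => Eq.symm hh) fun h hh => 𝒢.tgt_mul g h (Eq.symm hh)
  -- Both sides of the cocycle identity are now averaged over `h` in the target fibre at `x`.
  have hfaces := ha.sum Finset.univ (fun j : Fin (n + 2) => (-1 : ℝ) ^ (j : ℕ)) (x := x)
    (f := fun j => lastEval φ (𝒱.face (n + 1) j.castSucc ξ).1) fun j _ => by
      rw [← hsrc j]
      exact continuousOn_lastEval hφ _
  have hrest := ha.sum Finset.univ ![(-1 : ℝ) ^ n, (-1 : ℝ) ^ (n + 1)] (x := x)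
    (f := ![fun _ => φ ξ, fun h => lastEval φ ξ'.1 (𝒢.mul g h)]) fun j _ => by
      fin_cases j
      exacts [continuousOn_const, hcont_mul]
  simp only [Fin.sum_univ_two, Matrix.cons_val_zero, Matrix.cons_val_one] at hrest
  -- Normalization keeps the constant `φ ξ`, and left invariance turns the average of `h ↦ gh` into
  -- the average over the fibre at `tgt g`, which cancels the last face term of the differential.
  rw [ha.congr hcocycle, hrest, ha.const, ha.mul_left hcont] at hfaces
  rw [LieGroupoid.delta_apply, Fin.sum_univ_castSucc, LieGroupoid.face_last]
  simp only [averageLast, hsrc, Fin.val_castSucc, Fin.val_last, ← hfaces]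
  rw [hξ']
  simp only [pow_succ, Pi.smul_apply, smul_eq_mul, ξ']
  ring

end VBGroupoid

end

theorem proposition3p3
    {EM EG : Type*}
    [NormedAddCommGroup EM] [NormedSpace ℝ EM] [FiniteDimensional ℝ EM]
    [NormedAddCommGroup EG] [NormedSpace ℝ EG] [FiniteDimensional ℝ EG]
    {M : Type u} [TopologicalSpace M] [ChartedSpace EM M] [IsManifold 𝓘(ℝ, EM) ∞ M]
    [T2Space M] [SecondCountableTopology M]
    {G : Type u} [TopologicalSpace G] [ChartedSpace EG G] [IsManifold 𝓘(ℝ, EG) ∞ G]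
    [T2Space G] [SecondCountableTopology G] [MeasurableSpace G] [BorelSpace G]
    (𝒢 : LieGroupoid 𝓘(ℝ, EM) M 𝓘(ℝ, EG) G)
    {FE : Type*} [NormedAddCommGroup FE] [NormedSpace ℝ FE] [FiniteDimensional ℝ FE]
    {EE : M → Type u} [∀ x, AddCommGroup (EE x)] [∀ x, Module ℝ (EE x)]
    [∀ x, TopologicalSpace (EE x)] [TopologicalSpace (TotalSpace FE EE)] [FiberBundle FE EE]
    [VectorBundle ℝ FE EE] [ContMDiffVectorBundle ∞ FE EE 𝓘(ℝ, EM)]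
    {FV : Type*} [NormedAddCommGroup FV] [NormedSpace ℝ FV] [FiniteDimensional ℝ FV]
    {VV : G → Type u} [∀ g, AddCommGroup (VV g)] [∀ g, Module ℝ (VV g)]
    [∀ g, TopologicalSpace (VV g)] [TopologicalSpace (TotalSpace FV VV)] [FiberBundle FV VV]
    [VectorBundle ℝ FV VV] [ContMDiffVectorBundle ∞ FV VV 𝓘(ℝ, EG)]
    (𝒱 : VBGroupoid 𝒢 FE EE FV VV)
    (h𝒢 : 𝒢.IsProper ∨ ∃ (μ : 𝒢.HaarSystem) (c : M → ℝ), μ.IsCutoff c)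
    (p : ℕ) (hp : 2 ≤ p) :
    Subsingleton (𝒱.cohomology p) := by
  obtain ⟨n, rfl⟩ := Nat.exists_eq_add_of_le' hp
  have : LocallyCompactSpace M := Manifold.locallyCompact_of_finiteDimensional 𝓘(ℝ, EM)
  have : LocallyCompactSpace G := Manifold.locallyCompact_of_finiteDimensional 𝓘(ℝ, EG)
  -- Both alternatives of the hypothesis enter only through this function.
  obtain ⟨c, hc⟩ : ∃ c, 𝒢.IsFibreCutoff c := by
    rcases h𝒢 with h | ⟨μ, c, hc⟩
    exacts [h.exists_isFibreCutoff, ⟨_, hc.isFibreCutoff⟩]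
  obtain ⟨a, ha⟩ := hc.exists_isAverage
  refine Submodule.Quotient.subsingleton_iff.2 (eq_top_iff.2 fun φ _ => ?_)
  -- The sign of the primitive compensates the sign in the homotopy formula.
  refine ⟨(-1 : ℝ) ^ n • VBGroupoid.averageLast a φ.1, Submodule.smul_mem _ _
    (VBGroupoid.averageLast_mem_cochains ha φ.2.1), ?_⟩
  rw [map_smul, VBGroupoid.delta_averageLast ha φ.2, smul_smul, ← mul_pow]
  simp
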